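/- **Setting.** Let $X$ be a reflexive real Banach space with a topological direct sum decomposition $X=X^+\oplus\widetilde X$, and let $\widetilde X=X^0\oplus X^1$ with $X^0,X^1$ closed. Assume that $X^+$ and $X^0$ are Hilbert spaces for the norm of $X$ and that $\|u\|^2=\|u^+\|^2+\|\tilde u\|^2$ for $u=u^++\tilde u\in X^+\oplus\widetilde X$; write also $\tilde u=u^0+u^1\in X^0\oplus X^1$. Let $$J(u)=\tfrac12\|u^+\|^2-I(u),\qquad J_{cp}(u)=\tfrac12\|u^++u^0\|^2-I_{cp}(u)$$ be $\mathcal C^1$ functionals on $X$ and put $$\mathcal N=\{u\in X\setminus\widetilde X:\ J'(u)|_{\mathbb Ru\oplus\widetilde X}=0\},\qquad \mathcal N_{cp}=\{u\in X\setminus X^1:\ J_{cp}'(u)|_{\mathbb Ru\oplus X^1}=0\},$$ $c=\inf_{\mathcal N}J$, $d=\inf_{\mathcal N_{cp}}J_{cp}$ (with $\inf\emptyset=+\infty$). Let $\mathcal T$ be the product of the norm topology on $X^+$ and the weak topology on $\widetilde X$: $u_n\xrightarrow{\mathcal T}u$ iff $u_n^+\to u^+$ and $\tilde u_n\rightharpoonup\tilde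 u$. Conditions on $J$ (with respect to $X=X^+\oplus\widetilde X$): - (A1) $I\in\mathcal C^1(X,\mathbb R)$ and $I(u)\ge I(0)=0$ for all $u\in X$. - (A2) If $u_n\xrightarrow{\mathcal T}u$, then $\liminf I(u_n)\ge I(u)$. - (A3) If $u_n\xrightarrow{\mathcal T}u$ and $I(u_n)\to I(u)$, then $u_n\to u$. - (A4) There is $r>0$ with $\inf\{J(u):u\in X^+,\ \|u\|=r\}>0$. - (B1) $\|u^+\|+I(u)\to\infty$ as $\|u\|\to\infty$. - (B2) $I(t_nu_n)/t_n^2\to\infty$ whenever $t_n\to\infty$ and $u_n^+\to u^+$ for some $u^+\in X^+\setminus\{0\}$. - (B3) $\frac{t^2-1}2I'(u)(u)+tI'(u)(v)+I(u)-I(tu+v)<0$ for all $u\in\mathcal N$, $t\ge0$, $v\in\widetilde X$ with $u\ne tu+v$. The same conditions for $J_{cp}$ are obtained by replacing $X^+,\widetilde X,I,J,\mathcal N$ by $X^+\oplus X^0,\,X^1,\,I_{cp},\,J_{cp},\,\mathcal N_{cp}$ (also in the definition of $\mathcal T$). Further conditions: - (C1) If $(u_n)\subset\mathcal N_{cp}$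 is bounded and $u_n^++u_n^0\rightharpoonup0$, then $J_{cp}(u_n)-J(u_n)\to0$; and there is $M>0$ with $J_{cp}(u)-J(u)\le M\|u^++u^0\|^2$ for all $u\in\mathcal N_{cp}$. - (C2) $I(t_nu_n)/t_n^2\to\infty$ whenever $(u_n)\subset X$, $t_n\to\infty$ and, for every $t>1$, the sequence $(I(tu_n^+))_n$ is bounded away from $0$. - (C3) If $(u_n)\subset\mathcal N$ and $u_n\rightharpoonup u$ in $X$, then $J'(u_n)\to J'(u)$ weakly* in $X^*$; if moreover $u\in\mathcal N$, then $\liminf J(u_n)\ge J(u)$. A $(PS)_\beta$-sequence in $\mathcal N$ ($\beta\in\mathbb R$) is a sequence $(u_n)\subset\mathcal N$ with $J'(u_n)\to0$ in $X^*$ and $J(u_n)\to\beta$; $J$ satisfies $(PS)^{\mathcal T}_\beta$ in $\mathcal N$ if every such sequence has a subsequence that $\mathcal T$-converges to a point of $X$. For a closed symmetric set $A\subset X$ the Krasnoselskii genus $\gamma(A)\in\mathbb N_0\cup\{\infty\}$ is the least $k$ for which there is an odd continuous map $A\to\mathbb R^k\setminus\{0\}$ ($\infty$ if there is none, $\gamma(\emptyset)=0$).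 **Theorem 3.2.** Suppose that $J$ and $J_{cp}$ satisfy (A1)–(A4), (B1)–(B3), that $J$ is coercive on $\mathcal N$ ($J(u)\to\infty$ as $u\in\mathcal N$, $\|u\|\to\infty$) and that $J_{cp}$ is coercive on $\mathcal N_{cp}$. (a) If (C1)–(C2) hold and $\beta<d$, then every $(PS)_\beta$-sequence in $\mathcal N$ has a subsequence converging weakly in $X$ to some $u\neq0$. (b) If (C1)–(C3) hold and $c<d$, then $c$ is attained by a critical point: there is $u\in\mathcal N$ with $J'(u)=0$ and $J(u)=c$. (c) Suppose that $J$ is even and that, for some $\beta_0\in(c,+\infty]$, $J$ satisfies $(PS)^{\mathcal T}_\beta$ in $\mathcal N$ for every $\beta<\beta_0$. Let $$m(\mathcal N,\beta_0)=\sup\{\gamma(J^{-1}((0,\beta])\cap\mathcal N):\ \beta<\beta_0\}\in\mathbb N_0\cup\{\infty\}.$$ Then $J$ has at least $m(\mathcal N,\beta_0)$ pairs $\{u,-u\}$ of critical points with $u\ne0$ and $c\le J(u)<\beta_0$ (infinitely many if $m(\mathcal N,\beta_0)=\infty$). -/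

import Mathlib

open Filter Topology

noncomputable section

namespace NehariPankov

/-- A normed space is reflexive if the canonical embedding into its bidual is onto. -/
def IsReflexive (X : Type*) [NormedAddCommGroup X] [NormedSpace ℝ X] : Prop :=
  Function.Surjective (NormedSpace.inclusionInDoubleDual ℝ X)

/-- A direct sum decomposition `X = X⁺ ⊕ X̃`. (The two summands are closed in all uses below, see
`Decomposition`.) -/
structure Splitting (X : Type*) [NormedAddCommGroup X] [NormedSpace ℝ X] where
  /-- the summand `X⁺` -/
  plus : Submodule ℝ X
  /-- the summand `X̃` -/
  tilde : Submodule ℝ X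
  isCompl : IsCompl plus tilde

/-- A topological decomposition `X = X⁺ ⊕ X̃`, `X̃ = X⁰ ⊕ X¹`, all summands closed, where `X⁺` and
`X⁰` are Hilbert spaces for the norm of `X`, and `‖u‖² = ‖u⁺‖² + ‖ũ‖²`. That a closed
subspace is a Hilbert space for the given norm is expressed by the parallelogram identity
(Jordan–von Neumann). -/
structure Decomposition (X : Type*) [NormedAddCommGroup X] [NormedSpace ℝ X] where
  Xplus : Submodule ℝ X
  Xtilde : Submodule ℝ X
  Xzero : Submodule ℝ X
  Xone : Submodule ℝ X
  isClosed_plus : IsClosed (Xplus : Set X)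
  isClosed_tilde : IsClosed (Xtilde : Set X)
  isClosed_zero : IsClosed (Xzero : Set X)
  isClosed_one : IsClosed (Xone : Set X)
  isCompl_plus_tilde : IsCompl Xplus Xtilde
  sup_zero_one : Xzero ⊔ Xone = Xtilde
  disjoint_zero_one : Disjoint Xzero Xone
  hilbert_plus : InnerProductSpaceable Xplus
  hilbert_zero : InnerProductSpaceable Xzero
  norm_sq_add : ∀ u ∈ Xplus, ∀ v ∈ Xtilde, ‖u + v‖ ^ 2 = ‖u‖ ^ 2 + ‖v‖ ^ 2

section

variable {X : Type*} [NormedAddCommGroup X] [NormedSpace ℝ X]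

/-- The splitting `X = X⁺ ⊕ X̃`, used for `J`. -/
def Decomposition.coarse (D : Decomposition X) : Splitting X where
  plus := D.Xplus
  tilde := D.Xtilde
  isCompl := D.isCompl_plus_tilde

/-- The splitting `X = (X⁺ ⊕ X⁰) ⊕ X¹`, used for `J_cp`. -/
def Decomposition.fine (D : Decomposition X) : Splitting X where
  plus := D.Xplus ⊔ D.Xzero
  tilde := D.Xone
  isCompl := by
    have h := D.isCompl_plus_tilde
    rw [← D.sup_zero_one] at h
    refine ⟨?_, ?_⟩
    · exact Disjoint.disjoint_sup_left_of_disjoint_sup_right D.disjoint_zero_one h.disjoint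
    · rw [codisjoint_iff, sup_assoc]
      exact h.sup_eq_top

/-- The component `u⁺` of `u`. -/
def Splitting.pos (S : Splitting X) (u : X) : X :=
  S.plus.projection S.tilde S.isCompl u

/-- The component `ũ` of `u`. -/
def Splitting.neg (S : Splitting X) (u : X) : X := u - S.pos u

/-- Weak convergence of sequences in `X`. -/
def WeakTendsto (u : ℕ → X) (x : X) : Prop :=
  ∀ f : StrongDual ℝ X, Tendsto (fun n => f (u n)) atTop (𝓝 (f x))

/-- `𝒯`-convergence: norm convergence of `uₙ⁺`, weak convergence of `ũₙ`. (By
Hahn–Banach, weak convergence in the subspace `X̃` is weak convergence in `X`.) -/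
def Splitting.TTendsto (S : Splitting X) (u : ℕ → X) (x : X) : Prop :=
  Tendsto (fun n => S.pos (u n)) atTop (𝓝 (S.pos x)) ∧
    WeakTendsto (fun n => S.neg (u n)) (S.neg x)

/-- The functional `J(u) = ½‖u⁺‖² - I(u)`. -/
def Splitting.energy (S : Splitting X) (I : X → ℝ) (u : X) : ℝ :=
  (1 / 2) * ‖S.pos u‖ ^ 2 - I u

/-- The Nehari–Pankov manifold `{u ∈ X ∖ X̃ : J'(u) vanishes on ℝu ⊕ X̃}`. -/
def Splitting.nehari (S : Splitting X) (J : X → ℝ) : Set X :=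
  {u | u ∉ S.tilde ∧ ∀ w ∈ Submodule.span ℝ {u} ⊔ S.tilde, fderiv ℝ J u w = 0}

/-- The assumptions (A1)–(A4), (B1)–(B3) on `J(u) = ½‖u⁺‖² - I(u)`. -/
structure Splitting.Assumptions (S : Splitting X) (I : X → ℝ) : Prop where
  A1 : ContDiff ℝ 1 I ∧ I 0 = 0 ∧ ∀ u, 0 ≤ I u
  A2 : ∀ (u : ℕ → X) (x : X), S.TTendsto u x →
    (I x : EReal) ≤ liminf (fun n => (I (u n) : EReal)) atTop
  A3 : ∀ (u : ℕ → X) (x : X), S.TTendsto u x → Tendsto (fun n => I (u n)) atTop (𝓝 (I x)) →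
    Tendsto u atTop (𝓝 x)
  A4 : ∃ r > 0, ∃ a > 0, ∀ u ∈ S.plus, ‖u‖ = r → a ≤ S.energy I u
  B1 : Tendsto (fun u => ‖S.pos u‖ + I u) (Bornology.cobounded X) atTop
  B2 : ∀ (t : ℕ → ℝ) (u : ℕ → X) (x : X), Tendsto t atTop atTop → x ∈ S.plus → x ≠ 0 →
    Tendsto (fun n => S.pos (u n)) atTop (𝓝 x) →
    Tendsto (fun n => I (t n • u n) / t n ^ 2) atTop atTop
  B3 : ∀ u ∈ S.nehari (S.energy I), ∀ t : ℝ, 0 ≤ t → ∀ v ∈ S.tilde, u ≠ t • u + v →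
    (t ^ 2 - 1) / 2 * fderiv ℝ I u u + t * fderiv ℝ I u v + I u - I (t • u + v) < 0

/-- `J` is coercive on `N`: `J(u) → ∞` as `u ∈ N`, `‖u‖ → ∞`. -/
def CoerciveOn (J : X → ℝ) (N : Set X) : Prop :=
  Tendsto J (Bornology.cobounded X ⊓ 𝓟 N) atTop

/-- The infimum of `J` over `N`, with `inf ∅ = +∞`. -/
def infOn (J : X → ℝ) (N : Set X) : EReal := ⨅ u ∈ N, (J u : EReal)

/-- `u` is a `(PS)_β`-sequence in `N`. -/
def IsPSSeq (J : X → ℝ) (N : Set X) (β : ℝ) (u : ℕ → X) : Prop :=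
  (∀ n, u n ∈ N) ∧ Tendsto (fun n => fderiv ℝ J (u n)) atTop (𝓝 0) ∧
    Tendsto (fun n => J (u n)) atTop (𝓝 β)

/-- The `(PS)_β^𝒯`-condition in `N`. -/
def Splitting.PSCondition (S : Splitting X) (J : X → ℝ) (N : Set X) (β : ℝ) : Prop :=
  ∀ u : ℕ → X, IsPSSeq J N β u →
    ∃ (φ : ℕ → ℕ) (x : X), StrictMono φ ∧ S.TTendsto (u ∘ φ) x

/-- Condition (C1): `J_cp` is compactly perturbed with respect to `J`. Here `S` is the splitting
`(X⁺ ⊕ X⁰) ⊕ X¹`, so that `S.pos u = u⁺ + u⁰`, and `Ncp` is the manifold of `J_cp`. -/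
def CondC1 (S : Splitting X) (J Jcp : X → ℝ) (Ncp : Set X) : Prop :=
  (∀ u : ℕ → X, (∀ n, u n ∈ Ncp) → Bornology.IsBounded (Set.range u) →
    WeakTendsto (fun n => S.pos (u n)) 0 →
    Tendsto (fun n => Jcp (u n) - J (u n)) atTop (𝓝 0)) ∧
  ∃ M > 0, ∀ u ∈ Ncp, Jcp u - J u ≤ M * ‖S.pos u‖ ^ 2

/-- Condition (C2). -/
def CondC2 (S : Splitting X) (I : X → ℝ) : Prop :=
  ∀ (t : ℕ → ℝ) (u : ℕ → X), Tendsto t atTop atTop →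
    (∀ s : ℝ, 1 < s → ∃ δ > 0, ∀ n, δ ≤ I (s • S.pos (u n))) →
    Tendsto (fun n => I (t n • u n) / t n ^ 2) atTop atTop

/-- Condition (C3): `J'` is weak-to-weak* continuous on `N` and `J` is weakly sequentially lower
semicontinuous on `N`. -/
def CondC3 (J : X → ℝ) (N : Set X) : Prop :=
  (∀ (u : ℕ → X) (x : X), (∀ n, u n ∈ N) → WeakTendsto u x →
    ∀ w : X, Tendsto (fun n => fderiv ℝ J (u n) w) atTop (𝓝 (fderiv ℝ J x w))) ∧
  (∀ (u : ℕ → X) (x : X), (∀ n, u n ∈ N) → WeakTendsto u x → x ∈ N →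
    (J x : EReal) ≤ liminf (fun n => (J (u n) : EReal)) atTop)

/-- The Krasnoselskii genus of a (closed symmetric) set `A`: the least `k` such that there is an
odd continuous map `A → ℝᵏ ∖ {0}`, and `∞` if there is none; `γ(∅) = 0`. -/
def genus (A : Set X) : ℕ∞ :=
  ⨅ (k : ℕ) (_ : ∃ h : X → EuclideanSpace ℝ (Fin k), ContinuousOn h A ∧
    ∀ x ∈ A, h (-x) = -h x ∧ h x ≠ 0), (k : ℕ∞)

/-- `m(N, β₀) = sup {γ(J⁻¹((0, β]) ∩ N) : β < β₀}`. -/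
def genusCount (J : X → ℝ) (N : Set X) (β₀ : EReal) : ℕ∞ :=
  ⨆ (β : ℝ) (_ : (β : EReal) < β₀), genus (J ⁻¹' Set.Ioc 0 β ∩ N)

/-- The set of pairs `{u, -u}` with `u ≠ 0` a critical point of `J` and `c ≤ J(u) < β₀`. -/
def criticalPairs (J : X → ℝ) (c β₀ : EReal) : Set (Set X) :=
  (fun u : X => ({u, -u} : Set X)) ''
    {u | u ≠ 0 ∧ fderiv ℝ J u = 0 ∧ c ≤ (J u : EReal) ∧ (J u : EReal) < β₀}

end

end NehariPankov

end

open NehariPankov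

noncomputable section

namespace NehariPankov

/-! Everything rests on one consequence of (B3): a point `u` of the Nehari–Pankov set is the strict
maximum of `J` on the half-space `ℝ₊u⁺ ⊕ X̃` (`energy_lt_of_mem_nehari`). Conversely, reflexivity
with (B1) and (B2) makes maximising sequences on such a half-space `𝒯`-precompact, and (A2) makes
`J` upper semicontinuous along them. So each half-space contains exactly one such point
(`exists_mem_nehari`, `eq_of_mem_nehari`), and by (A3) it depends continuously on the ray
(`tendsto_nehariMap`). Thus `N` is a copy of the unit sphere of `X⁺`; for `J_cp` there is likewise
one point over each ray.

For (a), suppose `uₙ ⇀ x` with `x⁺ = 0`, and let `mₙ` be the point of `N_cp` over the ray of `uₙ⁺`.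
It lies in the half-space of `uₙ`, so `J(mₙ) ≤ J(uₙ)`. By (C2), the quadratic bound in (C1) and
coercivity, `mₙ` stays bounded, and (C1) gives `d ≤ J_cp(mₙ) ≤ J(uₙ) + o(1) → β`, contradicting `β <
d` (`exists_weak_limit_pos_ne_zero`).

For (b) and (c), the functional transported to the sphere is lowered by normalised gradient steps.
The maximum property yields a definite decrease although the parametrization is only known to be
continuous (`NehariSetting.descent`). Descent orbits give a Palais–Smale sequence at level `c`; by
the argument for (a) and (C3) its weak limit is a minimiser, which is (b).

For (c) one may assume finitely many critical pairs. Deforming sublevel sets by the iterated steps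
shows that crossing a critical level raises the genus by at most one and crossing any other level
does not raise it (`exists_oddMapOn_sublevel`). The genus is therefore at most the number of
critical levels, which is at most the number of pairs. -/

theorem exists_strictMono_lt_of_unbounded {t : ℕ → ℝ} (h : ¬∃ K, ∀ n, t n ≤ K) :
    ∃ φ : ℕ → ℕ, StrictMono φ ∧ ∀ n : ℕ, (n : ℝ) + 1 < t (φ n) := by
  refine extraction_forall_of_frequently (P := fun (K : ℕ) n => (K : ℝ) + 1 < t n)
    fun K hev => h ?_
  have : IsBoundedUnder (· ≤ ·) atTop t := ⟨(K : ℝ) + 1, by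
    rw [Filter.eventually_map]
    filter_upwards [hev] with n hn using not_lt.1 hn⟩
  obtain ⟨K', hK'⟩ := this.bddAbove_range
  exact ⟨K', fun n => hK' (Set.mem_range_self n)⟩

/-! ### Weak sequential compactness in reflexive spaces -/

section WeakConvergence

variable {X : Type*} [NormedAddCommGroup X] [NormedSpace ℝ X]

theorem mem_toStrongDual_preimage_closedBall {E : Type*} [SeminormedAddCommGroup E]
    [NormedSpace ℝ E] (x : WeakDual ℝ E) (C : ℝ) (h : ‖WeakDual.toStrongDual x‖ ≤ C) :
    x ∈ WeakDual.toStrongDual ⁻¹' Metric.closedBall (0 : StrongDual ℝ E) C :=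
  mem_closedBall_zero_iff.2 h

/-- A bounded sequence in a reflexive space has a weakly convergent subsequence. -/
theorem exists_subseq_weakTendsto (hX : IsReflexive X) (u : ℕ → X) (C : ℝ)
    (hu : ∀ n, ‖u n‖ ≤ C) :
    ∃ (φ : ℕ → ℕ) (x : X), StrictMono φ ∧ WeakTendsto (u ∘ φ) x := by
  -- Weak-* compactness in the bidual only gives cluster points. On the separable space `Y`
  -- countably many norming functionals `f j` separate points, so once all `f j (u (φ n))` converge
  -- the cluster point is unique, and compactness turns this into convergence.
  set Y : Submodule ℝ X := (Submodule.span ℝ (Set.range u)).topologicalClosure with hY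
  have huY : ∀ n, u n ∈ Y := fun n =>
    Submodule.le_topologicalClosure _ (Submodule.subset_span (Set.mem_range_self n))
  have hYsep : TopologicalSpace.IsSeparable (Y : Set X) := by
    rw [hY, Submodule.topologicalClosure_coe]
    exact ((Set.countable_range u).isSeparable.span).closure
  obtain ⟨c, hc, hYc⟩ := hYsep
  have hcne : c.Nonempty := by
    rw [← closure_nonempty_iff]
    exact ⟨0, hYc Y.zero_mem⟩
  obtain ⟨e, rfl⟩ := hc.exists_eq_range hcne
  choose f hf1 hf2 using fun j => exists_dual_vector'' ℝ (e j)
  have hsep : ∀ z ∈ Y, (∀ j, f j z = 0) → z = 0 := by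
    intro z hz hfz
    by_contra hne
    have hpos : 0 < ‖z‖ := norm_pos_iff.2 hne
    obtain ⟨_, ⟨j, rfl⟩, hj⟩ := Metric.mem_closure_iff.1 (hYc hz) (‖z‖ / 2) (by positivity)
    rw [dist_eq_norm] at hj
    have h1 : ‖e j‖ ≤ ‖z - e j‖ := by
      have h2 : f j (e j - z) = ‖e j‖ := by rw [map_sub, hfz, hf2]; simp
      have h3 := (f j).le_of_opNorm_le (hf1 j) (e j - z)
      rw [h2, one_mul, norm_sub_rev] at h3
      simpa using h3
    have h4 : ‖z‖ ≤ ‖z - e j‖ + ‖e j‖ := by simpa using norm_add_le (z - e j) (e j)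
    linarith
  have hcpt : IsCompact (Set.pi Set.univ fun _ : ℕ => Set.Icc (-C) C) :=
    isCompact_univ_pi fun _ => isCompact_Icc
  obtain ⟨a, -, φ, hφ, hlim⟩ := hcpt.tendsto_subseq (x := fun n j => f j (u n)) (by
    intro n j _
    have h3 := (f j).le_of_opNorm_le (hf1 j) (u n)
    rw [one_mul, Real.norm_eq_abs] at h3
    exact abs_le.1 (h3.trans (hu n)))
  rw [tendsto_pi_nhds] at hlim
  set ξ : ℕ → WeakDual ℝ (StrongDual ℝ X) := fun n =>
    StrongDual.toWeakDual (NormedSpace.inclusionInDoubleDual ℝ X (u (φ n))) with hξ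
  have hK := WeakDual.isCompact_closedBall (𝕜 := ℝ) (E := StrongDual ℝ X) 0 C
  have hξK : ∀ n, ξ n ∈ (WeakDual.toStrongDual ⁻¹' Metric.closedBall
      (0 : StrongDual ℝ (StrongDual ℝ X)) C) := by
    intro n
    have h1 : ‖NormedSpace.inclusionInDoubleDual ℝ X (u (φ n))‖ ≤ C :=
      (NormedSpace.double_dual_bound ℝ X (u (φ n))).trans (hu (φ n))
    exact mem_toStrongDual_preimage_closedBall _ _ h1
  have hcl : ∀ (x : X) (g : StrongDual ℝ X), MapClusterPt
      (StrongDual.toWeakDual (NormedSpace.inclusionInDoubleDual ℝ X x)) atTop ξ →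
      MapClusterPt (g x) atTop fun n => g (u (φ n)) := by
    intro x g hx
    have h2 : Tendsto (fun η : WeakDual ℝ (StrongDual ℝ X) => η g)
        (𝓝 (StrongDual.toWeakDual (NormedSpace.inclusionInDoubleDual ℝ X x))) (𝓝 (g x)) :=
      (WeakDual.eval_continuous g).tendsto _
    have h3 := MapClusterPt.tendsto_comp h2 hx
    exact h3
  have hclY : ∀ x : X, MapClusterPt
      (StrongDual.toWeakDual (NormedSpace.inclusionInDoubleDual ℝ X x)) atTop ξ → x ∈ Y := by
    intro x hx
    by_contra hxY
    obtain ⟨g, s, hs, hgs⟩ := geometric_hahn_banach_point_closed (t := (Y : Set X)) Y.convex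
      (Submodule.isClosed_topologicalClosure _) hxY
    have := (hcl x g hx).frequently (Iio_mem_nhds hs)
    obtain ⟨n, hn⟩ := this.exists
    exact lt_asymm hn (hgs _ (huY _))
  have hsurj : ∀ η : WeakDual ℝ (StrongDual ℝ X), ∃ x : X,
      StrongDual.toWeakDual (NormedSpace.inclusionInDoubleDual ℝ X x) = η := by
    intro η
    obtain ⟨x, hx⟩ := hX (WeakDual.toStrongDual η)
    exact ⟨x, by rw [hx]; rfl⟩
  obtain ⟨η₀, -, hη₀⟩ := hK.exists_mapClusterPt (f := atTop) (u := ξ)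
    (by rw [le_principal_iff]; exact Filter.mem_map.2 (Eventually.of_forall hξK))
  obtain ⟨x₀, rfl⟩ := hsurj η₀
  have hval : ∀ x : X, MapClusterPt
      (StrongDual.toWeakDual (NormedSpace.inclusionInDoubleDual ℝ X x)) atTop ξ →
      ∀ j, f j x = a j := by
    intro x hx j
    have h1 := hcl x (f j) hx
    have h2 : ClusterPt (f j x) (𝓝 (a j)) := ClusterPt.mono h1 (hlim j)
    by_contra hne
    exact h2.ne (disjoint_nhds_nhds.2 hne).eq_bot
  have huniq := hK.tendsto_nhds_of_unique_mapClusterPt (l := atTop) (f := ξ)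
    (y := StrongDual.toWeakDual (NormedSpace.inclusionInDoubleDual ℝ X x₀))
    (Eventually.of_forall hξK) (by
      intro η _ hη
      obtain ⟨x, rfl⟩ := hsurj η
      have : x - x₀ = 0 := hsep _ (Y.sub_mem (hclY x hη) (hclY x₀ hη₀)) fun j => by
        rw [map_sub, hval x hη j, hval x₀ hη₀ j, sub_self]
      rw [sub_eq_zero.1 this])
  refine ⟨φ, x₀, hφ, fun g => ?_⟩
  exact ((WeakDual.eval_continuous g).tendsto _).comp huniq

theorem WeakTendsto.comp_strictMono {u : ℕ → X} {x : X} (h : WeakTendsto u x) {φ : ℕ → ℕ}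
    (hφ : StrictMono φ) : WeakTendsto (u ∘ φ) x :=
  fun f => (h f).comp hφ.tendsto_atTop

theorem WeakTendsto.unique {u : ℕ → X} {x y : X} (hx : WeakTendsto u x) (hy : WeakTendsto u y) :
    x = y := by
  rw [SeparatingDual.eq_iff_forall_dual_eq (R := ℝ)]
  exact fun g => tendsto_nhds_unique (hx g) (hy g)

theorem WeakTendsto.map {u : ℕ → X} {x : X} (h : WeakTendsto u x) (T : X →L[ℝ] X) :
    WeakTendsto (fun n => T (u n)) (T x) :=
  fun f => h (f.comp T)

theorem weakTendsto_of_tendsto {u : ℕ → X} {x : X} (h : Tendsto u atTop (𝓝 x)) :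
    WeakTendsto u x :=
  fun f => (f.continuous.tendsto x).comp h

end WeakConvergence

/-! ### Projections of the two splittings -/

section Splitting

variable {X : Type*} [NormedAddCommGroup X] [NormedSpace ℝ X] (S : Splitting X)

namespace Splitting

theorem pos_add (u v : X) : S.pos (u + v) = S.pos u + S.pos v := map_add _ _ _

theorem pos_sub (u v : X) : S.pos (u - v) = S.pos u - S.pos v := map_sub _ _ _

theorem pos_neg (u : X) : S.pos (-u) = -S.pos u := map_neg _ _

theorem pos_smul (t : ℝ) (u : X) : S.pos (t • u) = t • S.pos u := map_smul _ _ _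

theorem pos_mem (u : X) : S.pos u ∈ S.plus := Submodule.projection_apply_mem _ _

theorem pos_of_mem {u : X} (hu : u ∈ S.plus) : S.pos u = u :=
  Submodule.projection_apply_of_mem_left _ hu

theorem pos_eq_zero_iff {u : X} : S.pos u = 0 ↔ u ∈ S.tilde :=
  Submodule.projection_apply_eq_zero_iff _

theorem pos_zero : S.pos 0 = 0 := map_zero _

theorem neg_mem (u : X) : S.neg u ∈ S.tilde := by
  rw [← S.pos_eq_zero_iff, neg, S.pos_sub, S.pos_of_mem (S.pos_mem u), sub_self]

theorem pos_add_neg (u : X) : S.pos u + S.neg u = u := add_sub_cancel _ _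

/-- Both projections of the splitting are continuous. -/
def IsTopological : Prop := Continuous S.pos

variable {S}

/-- The projection onto the first summand as a continuous linear map. -/
def posL (h : S.IsTopological) : X →L[ℝ] X := ⟨S.plus.projection S.tilde S.isCompl, h⟩

theorem posL_apply (h : S.IsTopological) (u : X) : S.posL h u = S.pos u := rfl

theorem isTopological_of_isClosed [CompleteSpace X] (hp : IsClosed (S.plus : Set X))
    (ht : IsClosed (S.tilde : Set X)) : S.IsTopological :=
  (Submodule.IsCompl.isTopCompl_of_isClosed S.isCompl hp ht).continuous_projection

theorem tTendsto_of_weakTendsto (h : S.IsTopological) {u : ℕ → X} {x : X}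
    (hu : WeakTendsto u x) (hp : Tendsto (fun n => S.pos (u n)) atTop (𝓝 (S.pos x))) :
    S.TTendsto u x :=
  ⟨hp, hu.map (ContinuousLinearMap.id ℝ X - S.posL h)⟩

end Splitting

variable [CompleteSpace X] (D : Decomposition X)

theorem Decomposition.isTopological_coarse : D.coarse.IsTopological :=
  Splitting.isTopological_of_isClosed D.isClosed_plus D.isClosed_tilde

/-- The sum `X⁺ ⊕ X⁰` is closed because it is the preimage of `X⁰` under the continuous projection
onto `X̃`. -/
theorem Decomposition.isTopological_fine : D.fine.IsTopological := by
  refine Splitting.isTopological_of_isClosed ?_ D.isClosed_one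
  have h : ((D.fine.plus : Submodule ℝ X) : Set X) = D.coarse.neg ⁻¹' D.Xzero := by
    ext u
    constructor
    · intro hu
      obtain ⟨p, hp, z, hz, rfl⟩ := Submodule.mem_sup.1 hu
      have hz' : z ∈ D.coarse.tilde := by
        change z ∈ D.Xtilde
        rw [← D.sup_zero_one]
        exact Submodule.mem_sup_left hz
      have : D.coarse.neg (p + z) = z := by
        rw [Splitting.neg, Splitting.pos_add, D.coarse.pos_of_mem hp,
          D.coarse.pos_eq_zero_iff.2 hz']
        abel
      simpa [this] using hz
    · intro hu
      rw [← D.coarse.pos_add_neg u]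
      exact Submodule.add_mem_sup (D.coarse.pos_mem u) hu
  rw [h]
  exact D.isClosed_zero.preimage (continuous_id.sub D.isTopological_coarse)

end Splitting

/-! ### Maxima on half-spaces and the Nehari–Pankov manifold -/

section Nehari

variable {X : Type*} [NormedAddCommGroup X] [NormedSpace ℝ X] {S : Splitting X} {I : X → ℝ}

namespace Splitting

theorem energy_add (u : X) : S.energy I u + I u = (1 / 2) * ‖S.pos u‖ ^ 2 := by
  simp [energy]

/-- Since `J + I = ½‖u⁺‖²` is constant along `X̃`, and an explicit quadratic along `u` in the next
lemma, comparing derivatives on lines avoids differentiating the norm. -/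
theorem fderiv_energy_of_mem_tilde (hJ : Differentiable ℝ (S.energy I)) (hI : Differentiable ℝ I)
    (u : X) {v : X} (hv : v ∈ S.tilde) : fderiv ℝ (S.energy I) u v = -fderiv ℝ I u v := by
  have h1 := ((hJ u).hasFDerivAt.hasLineDerivAt v).add ((hI u).hasFDerivAt.hasLineDerivAt v)
  have h2 : HasDerivAt (fun _ : ℝ => (1 / 2) * ‖S.pos u‖ ^ 2)
      (fderiv ℝ (S.energy I) u v + fderiv ℝ I u v) 0 := by
    refine h1.congr_of_eventuallyEq (Eventually.of_forall fun t => ?_)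
    simp only [Pi.add_apply]
    rw [energy_add, S.pos_add, S.pos_smul, S.pos_eq_zero_iff.2 hv, smul_zero, add_zero]
  have := h2.unique (hasDerivAt_const (0 : ℝ) _)
  linarith

theorem fderiv_energy_self (hJ : Differentiable ℝ (S.energy I)) (hI : Differentiable ℝ I)
    (u : X) : fderiv ℝ (S.energy I) u u = ‖S.pos u‖ ^ 2 - fderiv ℝ I u u := by
  have h1 := ((hJ u).hasFDerivAt.hasLineDerivAt u).add ((hI u).hasFDerivAt.hasLineDerivAt u)
  have h2 : HasDerivAt (fun t : ℝ => (1 / 2) * ((1 + t) ^ 2 * ‖S.pos u‖ ^ 2))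
      (fderiv ℝ (S.energy I) u u + fderiv ℝ I u u) 0 := by
    refine h1.congr_of_eventuallyEq (Eventually.of_forall fun t => ?_)
    simp only [Pi.add_apply]
    rw [energy_add, S.pos_add, S.pos_smul]
    have : S.pos u + t • S.pos u = (1 + t) • S.pos u := by rw [add_smul, one_smul]
    rw [this, norm_smul, mul_pow, Real.norm_eq_abs, sq_abs]
  have h3 : HasDerivAt (fun t : ℝ => (1 / 2) * ((1 + t) ^ 2 * ‖S.pos u‖ ^ 2)) (‖S.pos u‖ ^ 2) 0 := by
    have h4 := ((((hasDerivAt_id (0 : ℝ)).const_add 1).pow 2).mul_const (‖S.pos u‖ ^ 2)).const_mul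
      (1 / 2 : ℝ)
    refine h4.congr_deriv ?_
    simp
  have := h2.unique h3
  linarith

/-- A point of the Nehari–Pankov manifold is the strict maximum of the energy on the half-space
spanned by it. -/
theorem energy_lt_of_mem_nehari (hA : S.Assumptions I) (hJ : Differentiable ℝ (S.energy I))
    {u : X} (hu : u ∈ S.nehari (S.energy I)) {w : X} {s : ℝ} (hs : 0 ≤ s)
    (hw : S.pos w = s • S.pos u) (hne : w ≠ u) : S.energy I w < S.energy I u := by
  have hI : Differentiable ℝ I := hA.A1.1.differentiable one_ne_zero
  have hv : w - s • u ∈ S.tilde := by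
    rw [← S.pos_eq_zero_iff, S.pos_sub, S.pos_smul, hw, sub_self]
  have hsum : s • u + (w - s • u) = w := by abel
  have h := hA.B3 u hu s hs _ hv (by rw [hsum]; exact hne.symm)
  rw [hsum] at h
  have h1 := hu.2 u (Submodule.mem_sup_left (Submodule.mem_span_singleton_self u))
  have h2 := hu.2 _ (Submodule.mem_sup_right hv)
  rw [fderiv_energy_self hJ hI] at h1
  rw [fderiv_energy_of_mem_tilde hJ hI _ hv] at h2
  have h3 : fderiv ℝ I u (w - s • u) = 0 := by linarith
  have h4 : fderiv ℝ I u u = ‖S.pos u‖ ^ 2 := by linarith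
  -- With `I'(u)u = ‖u⁺‖²` and `I'(u)v = 0`, condition (B3) becomes exactly `J(w) < J(u)`.
  rw [h3, h4] at h
  have h5 : ‖S.pos w‖ ^ 2 = s ^ 2 * ‖S.pos u‖ ^ 2 := by
    rw [hw, norm_smul, mul_pow, Real.norm_eq_abs, sq_abs]
  simp only [energy, h5]
  linarith

theorem energy_le_of_mem_nehari (hA : S.Assumptions I) (hJ : Differentiable ℝ (S.energy I))
    {u : X} (hu : u ∈ S.nehari (S.energy I)) {w : X} {s : ℝ} (hs : 0 ≤ s)
    (hw : S.pos w = s • S.pos u) : S.energy I w ≤ S.energy I u := by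
  by_cases h : w = u
  · rw [h]
  · exact (energy_lt_of_mem_nehari hA hJ hu hs hw h).le

/-- Two distinct points on one half-space would each have strictly smaller energy than the other. -/
theorem eq_of_mem_nehari (hA : S.Assumptions I) (hJ : Differentiable ℝ (S.energy I))
    {u w p : X} (hu : u ∈ S.nehari (S.energy I)) (hw : w ∈ S.nehari (S.energy I))
    {s t : ℝ} (hs : 0 < s) (ht : 0 < t) (hup : S.pos u = s • p) (hwp : S.pos w = t • p) :
    u = w := by
  by_contra hne
  have h1 := energy_lt_of_mem_nehari hA hJ hw (w := u) (s := s / t) (by positivity)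
    (by rw [hup, hwp, smul_smul, div_mul_cancel₀ _ ht.ne']) hne
  have h2 := energy_lt_of_mem_nehari hA hJ hu (w := w) (s := t / s) (by positivity)
    (by rw [hup, hwp, smul_smul, div_mul_cancel₀ _ hs.ne']) (Ne.symm hne)
  exact lt_asymm h1 h2

theorem pos_ne_zero_of_mem_nehari {J : X → ℝ} {u : X} (hu : u ∈ S.nehari J) : S.pos u ≠ 0 :=
  fun h => hu.1 (S.pos_eq_zero_iff.1 h)

theorem energy_le_half (hA : S.Assumptions I) (u : X) :
    S.energy I u ≤ (1 / 2) * ‖S.pos u‖ ^ 2 := by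
  have := hA.A1.2.2 u
  simp only [energy]
  linarith

/-- The energy is bounded below by a positive constant on the Nehari–Pankov manifold. -/
theorem exists_pos_le_energy (hA : S.Assumptions I) (hJ : Differentiable ℝ (S.energy I)) :
    ∃ a > 0, ∀ u ∈ S.nehari (S.energy I), a ≤ S.energy I u := by
  obtain ⟨r, hr, a, ha, h⟩ := hA.A4
  refine ⟨a, ha, fun u hu => ?_⟩
  have hp : 0 < ‖S.pos u‖ := norm_pos_iff.2 (pos_ne_zero_of_mem_nehari hu)
  -- The half-space of `u` meets the sphere of radius `r` in `X⁺`, where (A4) applies.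
  refine (h ((r / ‖S.pos u‖) • S.pos u) (S.plus.smul_mem _ (S.pos_mem u)) ?_).trans ?_
  · rw [norm_smul, Real.norm_eq_abs, abs_of_pos (by positivity), div_mul_cancel₀ _ hp.ne']
  · exact energy_le_of_mem_nehari hA hJ hu (s := r / ‖S.pos u‖) (by positivity)
      (by rw [S.pos_smul, S.pos_of_mem (S.pos_mem u)])

theorem exists_norm_le (hA : S.Assumptions I) (R : ℝ) :
    ∃ C, ∀ u, ‖S.pos u‖ + I u ≤ R → ‖u‖ ≤ C := by
  have h := hA.B1.eventually (eventually_gt_atTop R)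
  obtain ⟨C, -, hC⟩ := (hasBasis_cobounded_norm.eventually_iff).1 h
  refine ⟨C, fun u hu => ?_⟩
  by_contra hlt
  have := hC (x := u) (le_of_lt (not_le.1 hlt))
  linarith

/-- `𝒯`-upper semicontinuity of the energy: `‖u⁺‖` is `𝒯`-continuous and (A2) controls `I`. -/
theorem le_energy_of_tTendsto (hA : S.Assumptions I) {w : ℕ → X} {x : X} (hw : S.TTendsto w x)
    {l : ℕ → ℝ} {L : ℝ} (hl : Tendsto l atTop (𝓝 L)) (hle : ∀ n, l n ≤ S.energy I (w n)) :
    L ≤ S.energy I x := by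
  refine le_of_forall_pos_le_add fun e he => ?_
  have h1 : ∀ᶠ n in atTop, I x - e < I (w n) := by
    have h2 : ((I x - e : ℝ) : EReal) < liminf (fun n => (I (w n) : EReal)) atTop :=
      lt_of_lt_of_le (by exact_mod_cast sub_lt_self _ he) (hA.A2 w x hw)
    filter_upwards [eventually_lt_of_lt_liminf h2] with n hn
    exact_mod_cast hn
  have h3 : Tendsto (fun n => (1 / 2) * ‖S.pos (w n)‖ ^ 2 - (I x - e)) atTop
      (𝓝 ((1 / 2) * ‖S.pos x‖ ^ 2 - (I x - e))) :=
    ((hw.1.norm.pow 2).const_mul _).sub_const _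
  have h4 : L ≤ (1 / 2) * ‖S.pos x‖ ^ 2 - (I x - e) := by
    refine le_of_tendsto_of_tendsto hl h3 ?_
    filter_upwards [h1] with n hn
    have := hle n
    simp only [energy] at this
    linarith
  simp only [energy]
  linarith

/-- The lower bound on the energies forces `limsup I(wₙ) ≤ I(x)`. Together with (A2) this gives
`I(wₙ) → I(x)`, so (A3) upgrades to norm convergence. -/
theorem tendsto_of_tTendsto_of_energy (hA : S.Assumptions I) {w : ℕ → X} {x : X}
    (hw : S.TTendsto w x) {l : ℕ → ℝ} (hl : Tendsto l atTop (𝓝 (S.energy I x)))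
    (hle : ∀ n, l n ≤ S.energy I (w n)) : Tendsto w atTop (𝓝 x) := by
  refine hA.A3 w x hw ?_
  rw [tendsto_order]
  constructor
  · intro b hb
    have h2 : (b : EReal) < liminf (fun n => (I (w n) : EReal)) atTop :=
      lt_of_lt_of_le (by exact_mod_cast hb) (hA.A2 w x hw)
    filter_upwards [eventually_lt_of_lt_liminf h2] with n hn
    exact_mod_cast hn
  · intro b hb
    have h3 : Tendsto (fun n => (1 / 2) * ‖S.pos (w n)‖ ^ 2 - l n) atTop
        (𝓝 ((1 / 2) * ‖S.pos x‖ ^ 2 - S.energy I x)) :=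
      ((hw.1.norm.pow 2).const_mul _).sub hl
    have h4 : (1 / 2) * ‖S.pos x‖ ^ 2 - S.energy I x = I x := by simp [energy]
    rw [h4] at h3
    filter_upwards [h3.eventually (gt_mem_nhds hb)] with n hn
    have := hle n
    simp only [energy] at this
    linarith

/-- If `tₙ` were unbounded, (B2) applied to `wₙ / tₙ`, whose positive parts converge to `q ≠ 0`,
would push the energy below `l`. With `tₙ` bounded, so is `I(wₙ)`, and (B1) bounds `wₙ`. The rays
are allowed to vary because continuity of the parametrization needs it. -/
theorem exists_subseq_tTendsto (hX : IsReflexive X) (hT : S.IsTopological) (hA : S.Assumptions I)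
    {p w : ℕ → X} {t : ℕ → ℝ} {q : X} {l : ℝ} (hp : Tendsto p atTop (𝓝 q)) (hq : q ∈ S.plus)
    (hq0 : q ≠ 0) (ht : ∀ n, 0 ≤ t n) (hw : ∀ n, S.pos (w n) = t n • p n)
    (hl : ∀ n, l ≤ S.energy I (w n)) :
    ∃ (φ : ℕ → ℕ) (x : X) (s : ℝ), StrictMono φ ∧ S.TTendsto (w ∘ φ) x ∧ 0 ≤ s ∧
      S.pos x = s • q := by
  obtain ⟨C, hC⟩ := (hp.norm.bddAbove_range)
  have hpC : ∀ n, ‖p n‖ ≤ C := fun n => hC (Set.mem_range_self n)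
  have hIw : ∀ n, I (w n) ≤ (1 / 2) * (t n * C) ^ 2 - l := by
    intro n
    have h1 := hl n
    have h2 : ‖S.pos (w n)‖ ≤ t n * C := by
      rw [hw, norm_smul, Real.norm_eq_abs, abs_of_nonneg (ht n)]
      exact mul_le_mul_of_nonneg_left (hpC n) (ht n)
    have h3 := pow_le_pow_left₀ (norm_nonneg _) h2 2
    simp only [energy] at h1
    linarith
  have hbdd : ∃ K, ∀ n, t n ≤ K := by
    by_contra hunb
    obtain ⟨φ, hφ, hφt⟩ := exists_strictMono_lt_of_unbounded hunb
    have ht1 : ∀ n, 1 < t (φ n) := fun n => by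
      have := hφt n
      have h0 : (0 : ℝ) ≤ n := Nat.cast_nonneg n
      linarith
    have htt : Tendsto (t ∘ φ) atTop atTop := by
      refine tendsto_atTop_mono (fun n => ?_) tendsto_natCast_atTop_atTop
      have := hφt n
      simp only [Function.comp_apply]
      linarith
    have hy : ∀ n, S.pos ((t (φ n))⁻¹ • w (φ n)) = p (φ n) := fun n => by
      rw [S.pos_smul, hw, smul_smul, inv_mul_cancel₀ (by linarith [ht1 n]), one_smul]
    have hB := hA.B2 (t ∘ φ) (fun n => (t (φ n))⁻¹ • w (φ n)) q htt hq hq0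
      (by simp only [hy]; exact hp.comp hφ.tendsto_atTop)
    obtain ⟨n, hn⟩ := (hB.eventually (eventually_gt_atTop ((1 / 2) * C ^ 2 + |l|))).exists
    have h1 := ht1 n
    have h2 : (0 : ℝ) < t (φ n) ^ 2 := by positivity
    simp only [Function.comp_apply] at hn
    rw [smul_smul, mul_inv_cancel₀ (by linarith), one_smul, lt_div_iff₀ h2] at hn
    have h3 := hIw (φ n)
    have h4 : |l| ≤ |l| * t (φ n) ^ 2 := le_mul_of_one_le_right (abs_nonneg l) (one_le_pow₀ h1.le)
    have h5 := neg_abs_le l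
    nlinarith
  obtain ⟨K, hK⟩ := hbdd
  have hC0 : 0 ≤ C := (norm_nonneg _).trans (hpC 0)
  have htC : ∀ n, t n * C ≤ K * C := fun n => mul_le_mul_of_nonneg_right (hK n) hC0
  obtain ⟨R, hR⟩ := exists_norm_le hA (K * C + ((1 / 2) * (K * C) ^ 2 - l))
  have hwR : ∀ n, ‖w n‖ ≤ R := by
    intro n
    refine hR _ (add_le_add ?_ ((hIw n).trans ?_))
    · rw [hw, norm_smul, Real.norm_eq_abs, abs_of_nonneg (ht n)]
      exact (mul_le_mul_of_nonneg_left (hpC n) (ht n)).trans (htC n)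
    · have := pow_le_pow_left₀ (mul_nonneg (ht n) hC0) (htC n) 2
      linarith
  obtain ⟨φ₁, x, hφ₁, hx⟩ := exists_subseq_weakTendsto hX w R hwR
  obtain ⟨s, hs, φ₂, hφ₂, hts⟩ := isCompact_Icc.tendsto_subseq (x := t ∘ φ₁)
    (s := Set.Icc 0 K) (fun n => ⟨ht _, hK _⟩)
  have hφ : StrictMono (φ₁ ∘ φ₂) := hφ₁.comp hφ₂
  have hxx : WeakTendsto (w ∘ φ₁ ∘ φ₂) x := hx.comp_strictMono hφ₂
  have hpos : Tendsto (fun n => S.pos ((w ∘ φ₁ ∘ φ₂) n)) atTop (𝓝 (s • q)) := by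
    have := hts.smul (hp.comp hφ.tendsto_atTop)
    refine this.congr fun n => ?_
    simp only [Function.comp_apply, hw]
  have hposx : S.pos x = s • q :=
    (hxx.map (S.posL hT)).unique (weakTendsto_of_tendsto hpos)
  exact ⟨φ₁ ∘ φ₂, x, s, hφ, tTendsto_of_weakTendsto hT hxx (hposx ▸ hpos), hs.1, hposx⟩

/-- The point is a maximiser of the energy over the half-space. By (A4) the maximum is positive, so
the maximiser has nonzero positive part and can be moved in all directions of `ℝu ⊕ X̃`. -/
theorem exists_mem_nehari (hX : IsReflexive X) (hT : S.IsTopological) (hA : S.Assumptions I)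
    (hJ : Differentiable ℝ (S.energy I)) {p : X} (hp : p ∈ S.plus) (hp0 : p ≠ 0) :
    ∃ u ∈ S.nehari (S.energy I), ∃ s : ℝ, 0 < s ∧ S.pos u = s • p := by
  set A : Set X := {w | ∃ t : ℝ, 0 ≤ t ∧ S.pos w = t • p} with hAdef
  have hcpt : ∀ (w : ℕ → X) (l : ℝ), (∀ n, w n ∈ A) → (∀ n, l ≤ S.energy I (w n)) →
      ∃ (φ : ℕ → ℕ) (x : X), StrictMono φ ∧ S.TTendsto (w ∘ φ) x ∧ x ∈ A := by
    intro w l hw hl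
    choose t ht htw using hw
    obtain ⟨φ, x, s, hφ, hx, hs, hxs⟩ := exists_subseq_tTendsto hX hT hA
      (tendsto_const_nhds (x := p)) hp hp0 ht htw hl
    exact ⟨φ, x, hφ, hx, s, hs, hxs⟩
  obtain ⟨r, hr, a, ha, hra⟩ := hA.A4
  have hpn : 0 < ‖p‖ := norm_pos_iff.2 hp0
  have hw₀ : (r / ‖p‖) • p ∈ A := ⟨r / ‖p‖, by positivity, by rw [S.pos_smul, S.pos_of_mem hp]⟩
  have hJw₀ : a ≤ S.energy I ((r / ‖p‖) • p) := by
    refine hra _ (S.plus.smul_mem _ hp) ?_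
    rw [norm_smul, Real.norm_eq_abs, abs_of_pos (by positivity), div_mul_cancel₀ _ hpn.ne']
  have hbdd : BddAbove (S.energy I '' A) := by
    by_contra hunb
    rw [not_bddAbove_iff] at hunb
    have : ∀ n : ℕ, ∃ w ∈ A, (n : ℝ) < S.energy I w := fun n => by
      obtain ⟨_, ⟨w, hw, rfl⟩, hn⟩ := hunb n
      exact ⟨w, hw, hn⟩
    choose w hwA hwn using this
    obtain ⟨φ, x, hφ, hx, -⟩ := hcpt w 0 hwA fun n => (Nat.cast_nonneg n).trans (hwn n).le
    obtain ⟨m, hm⟩ := exists_nat_gt (S.energy I x)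
    -- Dropping `m` terms leaves only energies above `m`, which exceeds the energy of the limit.
    have hx' : S.TTendsto (fun n => (w ∘ φ) (n + m)) x :=
      ⟨hx.1.comp (tendsto_add_atTop_nat m), fun f => (hx.2 f).comp (tendsto_add_atTop_nat m)⟩
    have := le_energy_of_tTendsto hA hx' (tendsto_const_nhds (x := (m : ℝ))) (fun n => by
      have h1 : m ≤ φ (n + m) := (Nat.le_add_left m n).trans (hφ.id_le _)
      exact (Nat.cast_le.2 h1).trans (hwn _).le)
    linarith
  obtain ⟨v, -, hv, hvA⟩ := exists_seq_tendsto_sSup ⟨_, Set.mem_image_of_mem _ hw₀⟩ hbdd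
  choose w hwA hwv using hvA
  obtain ⟨l, hl⟩ := hv.bddBelow_range
  obtain ⟨φ, x, hφ, hx, s, hs, hxs⟩ := hcpt w l hwA fun n => by
    rw [hwv]; exact hl (Set.mem_range_self n)
  have hmax : ∀ w ∈ A, S.energy I w ≤ S.energy I x := fun y hy =>
    (le_csSup hbdd (Set.mem_image_of_mem _ hy)).trans
      (le_energy_of_tTendsto hA hx (hv.comp hφ.tendsto_atTop) fun n => (hwv (φ n)).ge)
  have hJx : 0 < S.energy I x := ha.trans_le (hJw₀.trans (hmax _ hw₀))
  have hs0 : 0 < s := by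
    refine lt_of_le_of_ne hs fun h => ?_
    have := energy_le_half hA x
    rw [hxs, ← h] at this
    simp at this
    linarith
  have hposx : S.pos x ≠ 0 := by
    rw [hxs]
    exact smul_ne_zero hs0.ne' hp0
  refine ⟨x, ⟨fun h => hposx (S.pos_eq_zero_iff.2 h), fun y hy => ?_⟩, s, hs0, hxs⟩
  obtain ⟨y₁, hy₁, v, hv, rfl⟩ := Submodule.mem_sup.1 hy
  obtain ⟨b, rfl⟩ := Submodule.mem_span_singleton.1 hy₁
  have h1 := (hJ x).hasFDerivAt.hasLineDerivAt (b • x + v)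
  refine IsLocalMax.hasDerivAt_eq_zero ?_ h1
  -- For small `t` the factor `1 + t * b` is positive, so the perturbed point stays in the
  -- half-space.
  have h2 : ∀ᶠ t : ℝ in 𝓝 0, 0 < 1 + t * b := by
    have : ContinuousAt (fun t : ℝ => 1 + t * b) 0 := by fun_prop
    exact this.eventually (lt_mem_nhds (by simp))
  filter_upwards [h2] with t ht
  simp only [zero_smul, add_zero]
  refine hmax _ ⟨(1 + t * b) * s, by positivity, ?_⟩
  rw [S.pos_add, S.pos_smul, S.pos_add, S.pos_smul, S.pos_eq_zero_iff.2 hv, hxs]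
  module

variable (S I) in
/-- The point of the Nehari–Pankov manifold on the half-space spanned by `p`. -/
def nehariMap (p : X) : X :=
  Classical.epsilon fun u => u ∈ S.nehari (S.energy I) ∧ ∃ s : ℝ, 0 < s ∧ S.pos u = s • p

theorem nehariMap_spec (hX : IsReflexive X) (hT : S.IsTopological) (hA : S.Assumptions I)
    (hJ : Differentiable ℝ (S.energy I)) {p : X} (hp : p ∈ S.plus) (hp0 : p ≠ 0) :
    S.nehariMap I p ∈ S.nehari (S.energy I) ∧ ∃ s : ℝ, 0 < s ∧ S.pos (S.nehariMap I p) = s • p := by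
  have h : ∃ u, u ∈ S.nehari (S.energy I) ∧ ∃ s : ℝ, 0 < s ∧ S.pos u = s • p :=
    exists_mem_nehari hX hT hA hJ hp hp0
  exact Classical.epsilon_spec h

theorem nehariMap_eq (hX : IsReflexive X) (hT : S.IsTopological) (hA : S.Assumptions I)
    (hJ : Differentiable ℝ (S.energy I)) {u p : X} (hu : u ∈ S.nehari (S.energy I)) {s : ℝ}
    (hs : 0 < s) (hp : p ∈ S.plus) (h : S.pos u = s • p) : S.nehariMap I p = u := by
  have hp0 : p ≠ 0 := by
    rintro rfl
    exact pos_ne_zero_of_mem_nehari hu (by rw [h, smul_zero])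
  obtain ⟨h1, t, ht, h2⟩ := nehariMap_spec hX hT hA hJ hp hp0
  exact eq_of_mem_nehari hA hJ h1 hu ht hs h2 h

/-- The test points `u + b(pₙ - q)` lie over the rays of `pₙ` and tend to `u`, which bounds the
maxima from below by values tending to `J(u)`. Any `𝒯`-limit then has energy at least `J(u)` on the
half-space of `u`, hence equals `u`. -/
theorem tendsto_nehariMap (hX : IsReflexive X) (hT : S.IsTopological) (hA : S.Assumptions I)
    (hJ : ContDiff ℝ 1 (S.energy I)) {p : ℕ → X} {q : X} (hp : ∀ n, p n ∈ S.plus)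
    (hp0 : ∀ n, p n ≠ 0) (hq : q ∈ S.plus) (hq0 : q ≠ 0) (hpq : Tendsto p atTop (𝓝 q)) :
    Tendsto (fun n => S.nehariMap I (p n)) atTop (𝓝 (S.nehariMap I q)) := by
  have hJd : Differentiable ℝ (S.energy I) := hJ.differentiable one_ne_zero
  obtain ⟨a, ha, haN⟩ := exists_pos_le_energy hA hJd
  choose hN t ht hpt using fun n => nehariMap_spec hX hT hA hJd (hp n) (hp0 n)
  obtain ⟨hqN, b, hb, hqb⟩ := nehariMap_spec hX hT hA hJd hq hq0
  set u := S.nehariMap I q with hu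
  refine tendsto_of_subseq_tendsto fun ns hns => ?_
  obtain ⟨φ, x, s, hφ, hx, hs, hxs⟩ := exists_subseq_tTendsto hX hT hA (hpq.comp hns) hq hq0
    (w := fun n => S.nehariMap I (p (ns n))) (t := fun n => t (ns n)) (fun n => (ht _).le)
    (fun n => hpt _) (fun n => haN _ (hN _))
  refine ⟨φ, ?_⟩
  have hl : Tendsto (fun n => S.energy I (u + b • (p (ns (φ n)) - q))) atTop
      (𝓝 (S.energy I u)) := by
    have h1 : Tendsto (fun n => u + b • (p (ns (φ n)) - q)) atTop (𝓝 (u + b • (q - q))) :=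
      (((hpq.comp (hns.comp hφ.tendsto_atTop)).sub_const q).const_smul b).const_add u
    rw [sub_self, smul_zero, add_zero] at h1
    exact (hJ.continuous.tendsto u).comp h1
  have hle : ∀ n, S.energy I (u + b • (p (ns (φ n)) - q)) ≤
      S.energy I (S.nehariMap I (p (ns (φ n)))) := by
    intro n
    refine energy_le_of_mem_nehari hA hJd (hN _) (s := b / t (ns (φ n)))
      (div_nonneg hb.le (ht _).le) ?_
    rw [S.pos_add, S.pos_smul, S.pos_sub, S.pos_of_mem (hp _), S.pos_of_mem hq, hqb, hpt,
      smul_smul, div_mul_cancel₀ _ (ht _).ne', smul_sub, add_sub_cancel]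
  have h2 := le_energy_of_tTendsto hA hx hl hle
  have hxu : x = u := by
    by_contra hne
    refine absurd h2 (not_le.2 ?_)
    exact energy_lt_of_mem_nehari hA hJd hqN (s := s / b) (by positivity)
      (by rw [hxs, hqb, smul_smul, div_mul_cancel₀ _ hb.ne']) hne
  subst hxu
  exact tendsto_of_tTendsto_of_energy hA hx hl hle

end Splitting

end Nehari

/-! ### Comparison with `J_cp` and nonzero weak limits -/

section CompactPerturbation

theorem CoerciveOn.exists_norm_le {X : Type*} [NormedAddCommGroup X] {J : X → ℝ} {N : Set X} (h : CoerciveOn J N) (R : ℝ) :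
    ∃ C, ∀ u ∈ N, J u ≤ R → ‖u‖ ≤ C := by
  have h := h.eventually (eventually_gt_atTop R)
  rw [eventually_inf_principal] at h
  obtain ⟨C, -, hC⟩ := (hasBasis_cobounded_norm.eventually_iff).1 h
  refine ⟨C, fun u hu huR => ?_⟩
  by_contra hlt
  have := hC (x := u) (le_of_lt (not_le.1 hlt)) hu
  linarith

theorem infOn_le {X : Type*} {J : X → ℝ} {N : Set X} {u : X} (hu : u ∈ N) : infOn J N ≤ (J u : EReal) :=
  iInf₂_le u hu

variable {X : Type*} [NormedAddCommGroup X] [NormedSpace ℝ X]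

theorem fderiv_eq_zero_of_condC3 {J : X → ℝ} {N : Set X} (hC3 : CondC3 J N) {u : ℕ → X} {x : X}
    (hu : ∀ n, u n ∈ N) (hux : WeakTendsto u x)
    (h0 : Tendsto (fun n => fderiv ℝ J (u n)) atTop (𝓝 0)) : fderiv ℝ J x = 0 := by
  ext w
  refine tendsto_nhds_unique (hC3.1 u x hu hux w) ?_
  exact ((ContinuousLinearMap.apply ℝ ℝ w).continuous.tendsto 0).comp h0

theorem eq_infOn_of_condC3 {J : X → ℝ} {N : Set X} (hC3 : CondC3 J N) {u : ℕ → X} {x : X}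
    (hu : ∀ n, u n ∈ N) (hux : WeakTendsto u x) (hx : x ∈ N) {c : ℝ} (hc : (c : EReal) = infOn J N)
    (huc : Tendsto (fun n => J (u n)) atTop (𝓝 c)) : (J x : EReal) = c := by
  refine le_antisymm ?_ (hc.le.trans (infOn_le hx))
  have h : Tendsto (fun n => (J (u n) : EReal)) atTop (𝓝 c) :=
    (continuous_coe_real_ereal.tendsto c).comp huc
  exact h.liminf_eq ▸ hC3.2 u x hu hux hx

/-- From `J(s u⁺) ≤ J(u) ≤ ½‖u⁺‖²` and `a ≤ ½‖u⁺‖²`. This supplies the hypothesis of (C2) for the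
positive parts of points of `N`. -/
theorem Splitting.le_apply_smul_pos {S : Splitting X} {I : X → ℝ} (hA : S.Assumptions I)
    (hJ : Differentiable ℝ (S.energy I)) {a : ℝ}
    (ha : ∀ u ∈ S.nehari (S.energy I), a ≤ S.energy I u) {u : X}
    (hu : u ∈ S.nehari (S.energy I)) {s : ℝ} (hs : 1 < s) : (s ^ 2 - 1) * a ≤ I (s • S.pos u) := by
  have h1 := energy_le_of_mem_nehari hA hJ hu (w := s • S.pos u) (s := s) (by linarith)
    (by rw [S.pos_smul, S.pos_of_mem (S.pos_mem u)])
  have h2 := energy_le_half hA u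
  have h3 : S.energy I (s • S.pos u) = (1 / 2) * (s ^ 2 * ‖S.pos u‖ ^ 2) - I (s • S.pos u) := by
    rw [energy, S.pos_smul, S.pos_of_mem (S.pos_mem u), norm_smul, mul_pow, Real.norm_eq_abs,
      sq_abs]
  have h4 := ha u hu
  have h5 : 0 < s ^ 2 - 1 := by nlinarith
  nlinarith

variable {D : Decomposition X}

theorem Decomposition.plus_le : D.coarse.plus ≤ D.fine.plus := by
  change D.Xplus ≤ D.Xplus ⊔ D.Xzero
  exact le_sup_left

theorem Decomposition.tilde_le : D.fine.tilde ≤ D.coarse.tilde := by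
  change D.Xone ≤ D.Xtilde
  rw [← D.sup_zero_one]
  exact le_sup_right

theorem Decomposition.coarse_pos_eq {w p : X} (hp : p ∈ D.coarse.plus) (h : D.fine.pos w = p) :
    D.coarse.pos w = p := by
  rw [← D.fine.pos_add_neg w, D.coarse.pos_add, h, D.coarse.pos_of_mem hp,
    D.coarse.pos_eq_zero_iff.2 (D.tilde_le (D.fine.neg_mem w)), add_zero]

/-- Below the level of the comparison functional, sequences in the Nehari–Pankov manifold have
weak limits with nonzero positive part. -/
theorem exists_weak_limit_pos_ne_zero [CompleteSpace X] (hX : IsReflexive X) {I Icp : X → ℝ}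
    (hJ : ContDiff ℝ 1 (D.coarse.energy I)) (hJcp : ContDiff ℝ 1 (D.fine.energy Icp))
    (hI : D.coarse.Assumptions I) (hIcp : D.fine.Assumptions Icp)
    (hcoe : CoerciveOn (D.coarse.energy I) (D.coarse.nehari (D.coarse.energy I)))
    (hcoecp : CoerciveOn (D.fine.energy Icp) (D.fine.nehari (D.fine.energy Icp)))
    (hC1 : CondC1 D.fine (D.coarse.energy I) (D.fine.energy Icp)
      (D.fine.nehari (D.fine.energy Icp)))
    (hC2 : CondC2 D.coarse I) {β : ℝ}
    (hβ : (β : EReal) < infOn (D.fine.energy Icp) (D.fine.nehari (D.fine.energy Icp)))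
    {u : ℕ → X} (hu : ∀ n, u n ∈ D.coarse.nehari (D.coarse.energy I))
    (huβ : Tendsto (fun n => D.coarse.energy I (u n)) atTop (𝓝 β)) :
    ∃ (φ : ℕ → ℕ) (x : X), StrictMono φ ∧ WeakTendsto (u ∘ φ) x ∧ D.coarse.pos x ≠ 0 := by
  set S := D.coarse with hS
  set F := D.fine with hF
  have hJd : Differentiable ℝ (S.energy I) := hJ.differentiable one_ne_zero
  have hJcpd : Differentiable ℝ (F.energy Icp) := hJcp.differentiable one_ne_zero
  obtain ⟨B, hB⟩ := huβ.bddAbove_range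
  have hB' : ∀ n, S.energy I (u n) ≤ B := fun n => hB (Set.mem_range_self n)
  obtain ⟨R, hR⟩ := hcoe.exists_norm_le B
  obtain ⟨φ, x, hφ, hx⟩ := exists_subseq_weakTendsto hX u R fun n => hR _ (hu n) (hB' n)
  refine ⟨φ, x, hφ, hx, fun hx0 => ?_⟩
  set p : ℕ → X := fun n => S.pos (u (φ n)) with hp
  have hpw : WeakTendsto p 0 := by
    have := hx.map (S.posL D.isTopological_coarse)
    rw [S.posL_apply, hx0] at this
    exact this
  have hpm : ∀ n, p n ∈ S.plus := fun n => S.pos_mem _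
  have hpm' : ∀ n, p n ∈ F.plus := fun n => D.plus_le (hpm n)
  have hp0 : ∀ n, p n ≠ 0 := fun n => Splitting.pos_ne_zero_of_mem_nehari (hu _)
  choose hmN t ht hmt using fun n =>
    Splitting.nehariMap_spec hX D.isTopological_fine hIcp hJcpd (hpm' n) (hp0 n)
  set m : ℕ → X := fun n => F.nehariMap Icp (p n) with hm
  have hmS : ∀ n, S.pos (m n) = t n • p n := fun n =>
    D.coarse_pos_eq (S.plus.smul_mem _ (hpm n)) (hmt n)
  -- Since `X¹ ⊆ X̃`, the point `m n` also lies in the coarse half-space of `u (φ n)`.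
  have hJm : ∀ n, S.energy I (m n) ≤ S.energy I (u (φ n)) := fun n =>
    Splitting.energy_le_of_mem_nehari hI hJd (hu _) (ht n).le (hmS n)
  obtain ⟨hC1a, M, hM, hC1b⟩ := hC1
  set T := S.posL D.isTopological_coarse with hT
  have hpC : ∀ n, ‖p n‖ ≤ ‖T‖ * R := fun n => (T.le_opNorm (u (φ n))).trans
    (mul_le_mul_of_nonneg_left (hR _ (hu _) (hB' _)) (norm_nonneg _))
  set C := ‖T‖ * R with hC
  have hnorm : ∀ n, ‖t n • p n‖ ^ 2 ≤ t n ^ 2 * C ^ 2 := fun n => by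
    rw [norm_smul, mul_pow, Real.norm_eq_abs, sq_abs]
    exact mul_le_mul_of_nonneg_left (pow_le_pow_left₀ (norm_nonneg _) (hpC n) 2) (sq_nonneg _)
  have hJcpm : ∀ n, F.energy Icp (m n) ≤ S.energy I (m n) + M * (t n ^ 2 * C ^ 2) := fun n => by
    have h1 := hC1b (m n) (hmN n)
    rw [hmt n] at h1
    have h2 := mul_le_mul_of_nonneg_left (hnorm n) hM.le
    linarith
  obtain ⟨a, ha, haN⟩ := Splitting.exists_pos_le_energy hI hJd
  obtain ⟨a', ha', haN'⟩ := Splitting.exists_pos_le_energy hIcp hJcpd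
  -- Otherwise (C2) makes `I(mₙ)` outgrow `tₙ²` along a subsequence, against `0 < J_cp(mₙ) ≤ (½ + M)
  -- tₙ² C² - I(mₙ)`.
  have hbdd : ∃ K, ∀ n, t n ≤ K := by
    by_contra hunb
    obtain ⟨ψ, hψ, hψt⟩ := exists_strictMono_lt_of_unbounded hunb
    have hty : ∀ n, S.pos ((t (ψ n))⁻¹ • m (ψ n)) = p (ψ n) := fun n => by
      rw [S.pos_smul, hmS, smul_smul, inv_mul_cancel₀ (ht _).ne', one_smul]
    have htt : Tendsto (t ∘ ψ) atTop atTop := by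
      refine tendsto_atTop_mono (fun n => ?_) tendsto_natCast_atTop_atTop
      have := hψt n
      simp only [Function.comp_apply]
      linarith
    have h1 := hC2 (t ∘ ψ) (fun n => (t (ψ n))⁻¹ • m (ψ n)) htt fun s hs => by
      refine ⟨(s ^ 2 - 1) * a, mul_pos (by nlinarith) ha, fun n => ?_⟩
      rw [hty]
      exact Splitting.le_apply_smul_pos hI hJd haN (hu _) hs
    obtain ⟨n, hn⟩ := (h1.eventually (eventually_gt_atTop ((1 / 2 + M) * C ^ 2))).exists
    have h2 : 0 < t (ψ n) ^ 2 := pow_pos (ht _) 2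
    simp only [Function.comp_apply] at hn
    rw [smul_smul, mul_inv_cancel₀ (ht _).ne', one_smul, lt_div_iff₀ h2] at hn
    have h3 := hJcpm (ψ n)
    have h4 := haN' _ (hmN (ψ n))
    have h5 := hnorm (ψ n)
    have h6 : S.energy I (m (ψ n)) = (1 / 2) * ‖t (ψ n) • p (ψ n)‖ ^ 2 - I (m (ψ n)) := by
      rw [Splitting.energy, hmS]
    linarith
  obtain ⟨K, hK⟩ := hbdd
  have hweak : WeakTendsto (fun n => F.pos (m n)) 0 := by
    intro f
    have h1 : Tendsto (fun n => K * ‖f (p n)‖) atTop (𝓝 0) := by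
      have := ((hpw f).norm).const_mul K
      simpa using this
    rw [map_zero]
    refine squeeze_zero_norm (fun n => ?_) h1
    have h2 : F.pos (m n) = t n • p n := hmt n
    simp only [h2]
    rw [map_smul, norm_smul, Real.norm_eq_abs, abs_of_pos (ht n)]
    exact mul_le_mul_of_nonneg_right (hK n) (norm_nonneg _)
  obtain ⟨R', hR'⟩ := hcoecp.exists_norm_le (B + M * (K ^ 2 * C ^ 2))
  have hmb : Bornology.IsBounded (Set.range m) := by
    rw [isBounded_iff_forall_norm_le]
    refine ⟨R', ?_⟩
    rintro _ ⟨n, rfl⟩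
    refine hR' _ (hmN n) ((hJcpm n).trans (add_le_add ((hJm n).trans (hB' _)) ?_))
    exact mul_le_mul_of_nonneg_left (mul_le_mul_of_nonneg_right
      (pow_le_pow_left₀ (ht n).le (hK n) 2) (sq_nonneg _)) hM.le
  have hdiff := hC1a m hmN hmb hweak
  have hlim := (huβ.comp hφ.tendsto_atTop).add hdiff
  rw [add_zero] at hlim
  refine absurd hβ (not_lt.2 ?_)
  refine ge_of_tendsto' ((continuous_coe_real_ereal.tendsto β).comp hlim) fun n => ?_
  refine (infOn_le (hmN n)).trans ?_
  simp only [Function.comp_apply, EReal.coe_le_coe_iff]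
  have := hJm n
  linarith

end CompactPerturbation

/-! ### Odd maps and subadditivity of the genus -/

section OddMaps

variable {Y : Type*} [Neg Y]

/-- There is an odd continuous map from `A` to `ℝᵏ ∖ {0}`. -/
def OddMapOn [TopologicalSpace Y] (A : Set Y) (k : ℕ) : Prop :=
  ∃ h : Y → EuclideanSpace ℝ (Fin k), ContinuousOn h A ∧ ∀ x ∈ A, h (-x) = -h x ∧ h x ≠ 0

theorem OddMapOn.mono [TopologicalSpace Y] {A B : Set Y} {k : ℕ} (h : OddMapOn B k) (hAB : A ⊆ B) :
    OddMapOn A k := by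
  obtain ⟨f, hf, hf'⟩ := h
  exact ⟨f, hf.mono hAB, fun x hx => hf' x (hAB hx)⟩

theorem oddMapOn_empty [TopologicalSpace Y] (k : ℕ) : OddMapOn (∅ : Set Y) k :=
  ⟨fun _ => 0, continuousOn_empty _, fun _ h => h.elim⟩

/-- The odd map extends from `A` by Tietze and is made odd again by antisymmetrising; `f` is
adjoined as one more coordinate, which is nonzero where the extension may vanish. -/
theorem OddMapOn.union_ne_zero {Y : Type*} [MetricSpace Y] [InvolutiveNeg Y]
    (hneg : Continuous fun y : Y => -y) {A : Set Y} {k : ℕ}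
    (hA : IsClosed A) (hAneg : ∀ x ∈ A, -x ∈ A) (h : OddMapOn A k) {f : Y → ℝ}
    (hf : Continuous f) (hfodd : ∀ y, f (-y) = -f y) :
    OddMapOn (A ∪ {y | f y ≠ 0}) (k + 1) := by
  obtain ⟨g, hg, hg'⟩ := h
  have hT : TietzeExtension (EuclideanSpace ℝ (Fin k)) := TietzeExtension.of_tvs ℝ
  obtain ⟨G, hG⟩ := ContinuousMap.exists_restrict_eq hA ⟨A.domRestrict g, hg.domRestrict⟩
  have hGA : ∀ x ∈ A, G x = g x := fun x hx => congrArg (fun φ => φ ⟨x, hx⟩) hG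
  set G' : Y → EuclideanSpace ℝ (Fin k) := fun y => (1 / 2 : ℝ) • (G y - G (-y)) with hG'
  have hG'c : Continuous G' := (G.continuous.sub (G.continuous.comp hneg)).const_smul (1 / 2 : ℝ)
  have hG'odd : ∀ y, G' (-y) = -G' y := fun y => by
    simp only [hG', neg_neg, ← smul_neg, neg_sub]
  have hG'A : ∀ x ∈ A, G' x = g x := fun x hx => by
    simp only [hG', hGA x hx, hGA _ (hAneg x hx), (hg' x hx).1, sub_neg_eq_add]
    module
  refine ⟨fun y => WithLp.toLp 2 (Fin.cons (f y) (G' y)), ?_, ?_⟩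
  · refine Continuous.continuousOn ((PiLp.continuous_toLp 2 _).comp ?_)
    refine continuous_pi fun i => ?_
    refine Fin.cases ?_ (fun i => ?_) i
    · simpa using hf
    · simp only [Fin.cons_succ]
      exact (EuclideanSpace.proj i).continuous.comp hG'c
  · intro x hx
    refine ⟨?_, fun h0 => ?_⟩
    · ext i
      refine Fin.cases ?_ (fun i => ?_) i
      · simp [hfodd]
      · simp [hG'odd]
    · have h1 : ∀ i, (Fin.cons (f x) (G' x) : Fin (k + 1) → ℝ) i = 0 := fun i =>
        congrArg (fun v : EuclideanSpace ℝ (Fin (k + 1)) => v i) h0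
      rcases hx with hx | hx
      · refine (hg' x hx).2 ?_
        rw [← hG'A x hx]
        ext i
        simpa using h1 i.succ
      · exact hx (h1 0)

theorem OddMapOn.of_le {Y : Type*} [MetricSpace Y] [InvolutiveNeg Y]
    (hneg : Continuous fun y : Y => -y) {A : Set Y} {k l : ℕ}
    (hA : IsClosed A) (hAneg : ∀ x ∈ A, -x ∈ A) (h : OddMapOn A k) (hkl : k ≤ l) :
    OddMapOn A l := by
  induction l, hkl using Nat.le_induction with
  | base => exact h
  | succ l _ ih =>
    exact (ih.union_ne_zero hneg hA hAneg (f := fun _ => 0) continuous_const (by simp)).mono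
      Set.subset_union_left

/-- A finite symmetric set without fixed points has a neighbourhood on which some odd continuous
function does not vanish. -/
theorem exists_odd_ne_zero_near {Y : Type*} [MetricSpace Y] [InvolutiveNeg Y]
    (hiso : Isometry fun y : Y => -y) (hne : ∀ y : Y, -y ≠ y) {K : Set Y} (hK : K.Finite)
    (hKneg : ∀ x ∈ K, -x ∈ K) :
    ∃ f : Y → ℝ, Continuous f ∧ (∀ y, f (-y) = -f y) ∧
      ∃ δ > 0, ∀ y, (∃ p ∈ K, dist y p ≤ δ) → f y ≠ 0 := by
  -- A well-ordering selects one point `P` from each pair and leaves the other in `Q = -P`; the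
  -- difference of the distances to `Q` and `P` is odd and nonzero on `K`.
  set P : Set Y := {p | p ∈ K ∧ WellOrderingRel p (-p)} with hP
  set Q : Set Y := {p | p ∈ K ∧ WellOrderingRel (-p) p} with hQ
  have hPQ : (fun y : Y => -y) '' P = Q := by
    ext y
    constructor
    · rintro ⟨p, ⟨hp, hr⟩, rfl⟩
      exact ⟨hKneg p hp, by simpa using hr⟩
    · rintro ⟨hy, hr⟩
      exact ⟨-y, ⟨hKneg y hy, by simpa using hr⟩, neg_neg y⟩
  have hQP : (fun y : Y => -y) '' Q = P := by
    rw [← hPQ, Set.image_image]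
    simp
  have hPf : P.Finite := hK.subset fun p hp => hp.1
  have hQf : Q.Finite := hK.subset fun p hp => hp.1
  have hfc : Continuous fun y => Metric.infDist y Q - Metric.infDist y P :=
    (Metric.continuous_infDist_pt Q).sub (Metric.continuous_infDist_pt P)
  have hasymm : ∀ p, p ∈ P → p ∉ Q := fun p hp hq => asymm_of WellOrderingRel hp.2 hq.2
  have hpos : ∀ (A B : Set Y), B.Finite → B.Nonempty → ∀ p ∈ A, p ∉ B →
      Metric.infDist p A < Metric.infDist p B := by
    intro A B hB hBne p hpA hpB
    rw [Metric.infDist_zero_of_mem hpA]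
    exact (hB.isClosed.notMem_iff_infDist_pos hBne).1 hpB
  have hKne : ∀ p ∈ K, Metric.infDist p Q - Metric.infDist p P ≠ 0 := by
    intro p hp
    rcases trichotomous_of WellOrderingRel p (-p) with h | h | h
    · have hpP : p ∈ P := ⟨hp, h⟩
      have := hpos P Q hQf (hPQ ▸ ⟨_, Set.mem_image_of_mem _ hpP⟩) p hpP (hasymm p hpP)
      linarith
    · exact absurd h.symm (hne p)
    · have hpQ : p ∈ Q := ⟨hp, h⟩
      have := hpos Q P hPf (hQP ▸ ⟨_, Set.mem_image_of_mem _ hpQ⟩) p hpQ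
        fun h => hasymm p h hpQ
      linarith
  obtain ⟨δ, hδ, hsub⟩ := hK.isCompact.exists_cthickening_subset_open
    (isOpen_ne_fun hfc continuous_const) hKne
  refine ⟨_, hfc, fun y => ?_, δ, hδ, ?_⟩
  · have h1 : Metric.infDist (-y) Q = Metric.infDist y P := by
      rw [← hPQ]; exact Metric.infDist_image hiso
    have h2 : Metric.infDist (-y) P = Metric.infDist y Q := by
      rw [← hQP]; exact Metric.infDist_image hiso
    rw [h1, h2, neg_sub]
  · rintro y ⟨p, hp, hyp⟩
    exact hsub (Metric.mem_cthickening_of_dist_le y p δ K hp hyp)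

end OddMaps

/-! ### Discrete descent, deformation and genus of sublevel sets -/

section Deformation

/-- A functional `Ψ` on a metric space with a continuous `slope` and a continuous `step` which
locally decreases `Ψ` at a definite rate away from the zeros of `slope`. -/
structure DescentSystem (Y : Type*) [MetricSpace Y] where
  Ψ : Y → ℝ
  slope : Y → ℝ
  step : Y → ℝ → Y
  κ : ℝ
  κ_pos : 0 < κ
  continuous_Ψ : Continuous Ψ
  continuous_slope : Continuous slope
  slope_nonneg : ∀ y, 0 ≤ slope y
  continuous_step : Continuous fun z : Y × ℝ => step z.1 z.2
  step_zero : ∀ y, step y 0 = y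
  dist_step_le : ∀ y s, 0 ≤ s → dist (step y s) y ≤ 2 * s * slope y
  descent : ∀ y, slope y ≠ 0 → ∀ᶠ z in 𝓝 ((y, 0) : Y × ℝ), 0 ≤ z.2 →
    Ψ (step z.1 z.2) ≤ Ψ z.1 - κ * z.2 * slope z.1 ^ 2

namespace DescentSystem

variable {Y : Type*} [MetricSpace Y] (V : DescentSystem Y)

/-- The data of a descent system are compatible with a fixed-point-free isometric involution. -/
structure IsEven [InvolutiveNeg Y] : Prop where
  isometry_neg : Isometry fun y : Y => -y
  neg_ne : ∀ y : Y, -y ≠ y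
  Ψ_neg : ∀ y, V.Ψ (-y) = V.Ψ y
  slope_neg : ∀ y, V.slope (-y) = V.slope y
  step_neg : ∀ y s, V.step (-y) s = -V.step y s

/-- The pairs at which the step is too long for a definite decrease. -/
def bad : Set (Y × ℝ) :=
  {z | 1 ≤ z.2 ∨ 0 ≤ z.2 ∧ V.Ψ z.1 - V.κ * z.2 * V.slope z.1 ^ 2 < V.Ψ (V.step z.1 z.2)}

/-- An admissible step length, depending continuously on the point. -/
def τ (y : Y) : ℝ := Metric.infDist ((y, 0) : Y × ℝ) V.bad / 2

/-- The reason for the clause `1 ≤ z.2` in `bad`: `Metric.infDist` to the empty set is `0`, which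
would make `τ` vanish. -/
theorem bad_nonempty (y : Y) : ((y, 1) : Y × ℝ) ∈ V.bad := Or.inl le_rfl

theorem continuous_τ : Continuous V.τ :=
  ((Metric.continuous_infDist_pt _).comp (by fun_prop)).div_const 2

theorem τ_nonneg (y : Y) : 0 ≤ V.τ y := div_nonneg Metric.infDist_nonneg zero_le_two

theorem τ_pos {y : Y} (hy : V.slope y ≠ 0) : 0 < V.τ y := by
  refine half_pos ((Metric.infDist_pos_iff_notMem_closure ⟨_, V.bad_nonempty y⟩).1 ?_)
  rw [mem_closure_iff_frequently, not_frequently]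
  have h1 : ∀ᶠ z : Y × ℝ in 𝓝 (y, 0), z.2 < 1 :=
    continuous_snd.continuousAt.eventually (gt_mem_nhds zero_lt_one)
  filter_upwards [V.descent y hy, h1] with z hz hz1
  rintro (h | ⟨h2, h3⟩)
  · exact absurd h (not_le.2 hz1)
  · exact absurd (hz h2) (not_le.2 h3)

/-- A bad pair `(y, s)` has distance `s` from `(y, 0)`, hence `2 * τ y ≤ s`. The halving in `τ`
makes the step `s = τ y` itself admissible. -/
theorem Ψ_step_le {y : Y} {s : ℝ} (hs : 0 ≤ s) (hsτ : s ≤ V.τ y) :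
    V.Ψ (V.step y s) ≤ V.Ψ y - V.κ * s * V.slope y ^ 2 := by
  rcases hs.eq_or_lt with rfl | hs0
  · simp [V.step_zero]
  by_contra hlt
  have h1 : ((y, s) : Y × ℝ) ∈ V.bad := Or.inr ⟨hs, not_le.1 hlt⟩
  have h2 := Metric.infDist_le_dist_of_mem (x := ((y, 0) : Y × ℝ)) h1
  rw [Prod.dist_eq] at h2
  simp only [dist_self, Real.dist_eq, zero_sub, abs_neg, abs_of_pos hs0,
    max_eq_right hs] at h2
  simp only [τ] at hsτ
  linarith

theorem Ψ_step_le_self {y : Y} {s : ℝ} (hs : 0 ≤ s) (hsτ : s ≤ V.τ y) :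
    V.Ψ (V.step y s) ≤ V.Ψ y := by
  have h1 := V.Ψ_step_le hs hsτ
  have h2 : 0 ≤ V.κ * s * V.slope y ^ 2 := mul_nonneg (mul_nonneg V.κ_pos.le hs) (sq_nonneg _)
  linarith

/-- One full step of the descent. -/
def next (y : Y) : Y := V.step y (V.τ y)

theorem continuous_next : Continuous V.next :=
  V.continuous_step.comp (continuous_id.prodMk V.continuous_τ)

theorem dist_next_le {y : Y} {σ : ℝ} (hσ : 0 < σ) (hy : σ ≤ V.slope y) :
    V.κ * σ / 2 * dist (V.next y) y ≤ V.Ψ y - V.Ψ (V.next y) := by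
  have h1 := V.Ψ_step_le (V.τ_nonneg y) le_rfl
  have h2 := V.dist_step_le y _ (V.τ_nonneg y)
  have hκσ : 0 ≤ V.κ * σ / 2 := by have := V.κ_pos; positivity
  calc V.κ * σ / 2 * dist (V.next y) y ≤ V.κ * σ / 2 * (2 * V.τ y * V.slope y) :=
        mul_le_mul_of_nonneg_left h2 hκσ
    _ = V.κ * V.τ y * V.slope y * σ := by ring
    _ ≤ V.κ * V.τ y * V.slope y * V.slope y := mul_le_mul_of_nonneg_left hy
        (mul_nonneg (mul_nonneg V.κ_pos.le (V.τ_nonneg y)) (V.slope_nonneg y))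
    _ = V.κ * V.τ y * V.slope y ^ 2 := by ring
    _ ≤ V.Ψ y - V.Ψ (V.next y) := by
        simp only [next]
        linarith

/-- With slope at least `σ` the total decrease bounds the length of the orbit, so the orbit
converges. At the limit `τ` is positive, so the decreases cannot tend to `0`. -/
theorem not_slope_ge_orbit [CompleteSpace Y] {y : Y} {σ l : ℝ} (hσ : 0 < σ)
    (hs : ∀ k, σ ≤ V.slope (V.next^[k] y)) (hl : ∀ k, l ≤ V.Ψ (V.next^[k] y)) : False := by
  set x : ℕ → Y := fun k => V.next^[k] y with hx
  have hxs : ∀ k, x (k + 1) = V.next (x k) := fun k => Function.iterate_succ_apply' _ _ _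
  have hκσ : 0 < V.κ * σ / 2 := by have := V.κ_pos; positivity
  set d : ℕ → ℝ := fun k => V.Ψ (x k) - V.Ψ (x (k + 1)) with hd
  have hdx : ∀ k, V.κ * σ / 2 * dist (x k) (x (k + 1)) ≤ d k := fun k => by
    rw [dist_comm, hd]
    simp only [hxs]
    exact V.dist_next_le hσ (hs k)
  have hd0 : ∀ k, 0 ≤ d k := fun k => (mul_nonneg hκσ.le dist_nonneg).trans (hdx k)
  have hsum : Summable d := by
    refine summable_of_sum_range_le hd0 (c := V.Ψ (x 0) - l) fun n => ?_
    rw [hd, Finset.sum_range_sub' (fun k => V.Ψ (x k))]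
    have := hl n
    linarith
  have hcauchy : CauchySeq x := by
    refine cauchySeq_of_dist_le_of_summable _ (fun k => ?_) (hsum.mul_left (V.κ * σ / 2)⁻¹)
    rw [inv_mul_eq_div, le_div_iff₀ hκσ, mul_comm]
    exact hdx k
  obtain ⟨z, hz⟩ := cauchySeq_tendsto_of_complete hcauchy
  have hzs : σ ≤ V.slope z := ge_of_tendsto' ((V.continuous_slope.tendsto z).comp hz) hs
  have hτ : 0 < V.τ z := V.τ_pos (hσ.trans_le hzs).ne'
  have hlim : Tendsto (fun k => V.κ * V.τ (x k) * σ ^ 2) atTop (𝓝 (V.κ * V.τ z * σ ^ 2)) :=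
    (((V.continuous_τ.tendsto z).comp hz).const_mul _).mul_const _
  have h0 : V.κ * V.τ z * σ ^ 2 ≤ 0 := by
    refine le_of_tendsto_of_tendsto' hlim hsum.tendsto_atTop_zero fun k => ?_
    have h1 := V.Ψ_step_le (V.τ_nonneg (x k)) le_rfl
    have h2 : σ ^ 2 ≤ V.slope (x k) ^ 2 := pow_le_pow_left₀ hσ.le (hs k) 2
    have h3 := mul_le_mul_of_nonneg_left h2 (mul_nonneg V.κ_pos.le (V.τ_nonneg (x k)))
    simp only [hd, hxs, next]
    linarith
  have h1 : 0 < V.κ * V.τ z * σ ^ 2 := by have := V.κ_pos; positivity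
  linarith

theorem Ψ_iterate_le (y : Y) (k : ℕ) : V.Ψ (V.next^[k] y) ≤ V.Ψ y := by
  induction k with
  | zero => exact le_rfl
  | succ k ih =>
    rw [Function.iterate_succ_apply']
    exact (V.Ψ_step_le_self (V.τ_nonneg _) le_rfl).trans ih

/-- A functional that is bounded below has points of small slope in every sublevel set. -/
theorem exists_slope_lt [CompleteSpace Y] {l : ℝ} (hl : ∀ y, l ≤ V.Ψ y) (y : Y) {σ : ℝ}
    (hσ : 0 < σ) : ∃ z, V.Ψ z ≤ V.Ψ y ∧ V.slope z < σ := by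
  by_contra! h
  exact V.not_slope_ge_orbit hσ (fun k => h _ (V.Ψ_iterate_le y k)) fun k => hl _

/-- While the orbit stays in the band of width `2 * e` it travels at most `δ / 2`, hence keeps
distance `δ / 2` from `K`, where the slope is at least `σ`. By `not_slope_ge_orbit` this cannot last
forever. -/
theorem exists_iterate_lt [CompleteSpace Y] {b e σ δ : ℝ} {K : Set Y} (hσ : 0 < σ)
    (heδ : 2 * e ≤ V.κ * σ / 2 * (δ / 2))
    (hslope : ∀ y, b - e ≤ V.Ψ y → V.Ψ y ≤ b + e → (∀ p ∈ K, δ / 2 ≤ dist y p) → σ ≤ V.slope y)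
    {y : Y} (hy : V.Ψ y ≤ b + e) (hyK : ∀ p ∈ K, δ ≤ dist y p) :
    ∃ k, V.Ψ (V.next^[k] y) < b - e := by
  by_contra! h
  have hκσ : 0 < V.κ * σ / 2 := by have := V.κ_pos; positivity
  have hstep : ∀ k, V.κ * σ / 2 * dist y (V.next^[k] y) ≤ V.Ψ y - V.Ψ (V.next^[k] y) →
      σ ≤ V.slope (V.next^[k] y) := by
    intro k hk
    refine hslope _ (h k) ((V.Ψ_iterate_le y k).trans hy) fun p hp => ?_
    have h1 : V.κ * σ / 2 * dist y (V.next^[k] y) ≤ V.κ * σ / 2 * (δ / 2) := by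
      have := h k
      linarith
    have h2 := le_of_mul_le_mul_left h1 hκσ
    have h3 := hyK p hp
    have h4 := dist_triangle y (V.next^[k] y) p
    linarith
  have hall : ∀ k, V.κ * σ / 2 * dist y (V.next^[k] y) ≤ V.Ψ y - V.Ψ (V.next^[k] y) := by
    intro k
    induction k with
    | zero => simp
    | succ k ih =>
      have h1 := V.dist_next_le hσ (hstep k ih)
      rw [Function.iterate_succ_apply']
      have h2 := dist_triangle y (V.next^[k] y) (V.next (V.next^[k] y))
      rw [dist_comm (V.next^[k] y)] at h2
      have h3 := mul_le_mul_of_nonneg_left h2 hκσ.le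
      linarith
  exact V.not_slope_ge_orbit hσ (fun k => hstep k (hall k)) h

/-- One unit of time of the piecewise flow, acting on points with a remaining time. -/
def flowStep (z : Y × ℝ) : Y × ℝ := (V.step z.1 (min z.2 1 * V.τ z.1), max (z.2 - 1) 0)

theorem continuous_flowStep : Continuous V.flowStep := by
  have h1 := V.continuous_τ
  have h2 : Continuous fun z : Y × ℝ => (z.1, min z.2 1 * V.τ z.1) := by fun_prop
  exact (V.continuous_step.comp h2).prodMk (by fun_prop)

theorem flowStep_zero (y : Y) : V.flowStep (y, 0) = (y, 0) := by
  simp [flowStep, V.step_zero]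

theorem flowStep_snd_nonneg (z : Y × ℝ) : 0 ≤ (V.flowStep z).2 := le_max_right _ _

theorem Ψ_flowStep_le {z : Y × ℝ} (hz : 0 ≤ z.2) : V.Ψ (V.flowStep z).1 ≤ V.Ψ z.1 :=
  V.Ψ_step_le_self (mul_nonneg (le_min hz zero_le_one) (V.τ_nonneg _))
    (mul_le_of_le_one_left (V.τ_nonneg _) (min_le_right _ _))

theorem Ψ_flowStep_iterate_le {z : Y × ℝ} (hz : 0 ≤ z.2) (n : ℕ) :
    0 ≤ (V.flowStep^[n] z).2 ∧ V.Ψ (V.flowStep^[n] z).1 ≤ V.Ψ z.1 := by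
  induction n with
  | zero => exact ⟨hz, le_rfl⟩
  | succ n ih =>
    rw [Function.iterate_succ_apply']
    exact ⟨V.flowStep_snd_nonneg _, (V.Ψ_flowStep_le ih.1).trans ih.2⟩

theorem flowStep_iterate_of_le (y : Y) {r : ℝ} (k : ℕ) (hk : (k : ℝ) ≤ r) :
    V.flowStep^[k] (y, r) = (V.next^[k] y, r - k) := by
  induction k with
  | zero => simp
  | succ k ih =>
    push_cast at hk
    rw [Function.iterate_succ_apply', ih (by linarith), Function.iterate_succ_apply', flowStep,
      min_eq_right (by linarith), one_mul, max_eq_left (by linarith), next]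
    push_cast
    rw [sub_sub]

theorem flowStep_iterate_snd {y : Y} {r : ℝ} (hr : 0 ≤ r) (n : ℕ) :
    (V.flowStep^[n] (y, r)).2 = max (r - n) 0 := by
  induction n with
  | zero => simp [hr]
  | succ n ih =>
    rw [Function.iterate_succ_apply', flowStep, ih]
    push_cast
    rcases le_total (r - n) 0 with h | h
    · rw [max_eq_right h, max_eq_right (by linarith), max_eq_right (by linarith)]
    · rw [max_eq_left h, sub_sub]

/-- The piecewise flow. -/
def flow (y : Y) (r : ℝ) : Y := (V.flowStep^[⌈r⌉₊] (y, r)).1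

theorem flow_eq {y : Y} {r : ℝ} (hr : 0 ≤ r) {n : ℕ} (hn : r ≤ n) :
    V.flow y r = (V.flowStep^[n] (y, r)).1 := by
  obtain ⟨m, rfl⟩ := Nat.exists_eq_add_of_le (Nat.ceil_le.2 hn)
  have h1 : V.flowStep^[⌈r⌉₊] (y, r) = (V.flow y r, 0) := by
    refine Prod.ext rfl ?_
    rw [V.flowStep_iterate_snd hr, max_eq_right (by linarith [Nat.le_ceil r])]
  rw [add_comm, Function.iterate_add_apply, h1,
    Function.iterate_fixed (V.flowStep_zero _)]

/-- Extra iterations after the time has run out change nothing, so near each point one fixed number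
of iterations computes the flow. -/
theorem continuous_flow {θ : Y → ℝ} (hθ : Continuous θ) (hθ0 : ∀ y, 0 ≤ θ y) :
    Continuous fun y => V.flow y (θ y) := by
  rw [continuous_iff_continuousAt]
  intro y
  obtain ⟨n, hn⟩ := exists_nat_gt (θ y)
  have h1 : ContinuousAt (fun y => (V.flowStep^[n] (y, θ y)).1) y :=
    (continuous_fst.comp ((V.continuous_flowStep.iterate n).comp
      (continuous_id.prodMk hθ))).continuousAt
  refine h1.congr ?_
  filter_upwards [hθ.continuousAt.eventually (gt_mem_nhds hn)] with z hz
  exact (V.flow_eq (hθ0 z) hz.le).symm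

theorem Ψ_flow_le {y : Y} {r : ℝ} {k : ℕ} (hk : (k : ℝ) ≤ r) :
    V.Ψ (V.flow y r) ≤ V.Ψ (V.next^[k] y) := by
  have hr : 0 ≤ r := (Nat.cast_nonneg k).trans hk
  obtain ⟨m, hm⟩ := Nat.exists_eq_add_of_le (Nat.cast_le.1 (hk.trans (Nat.le_ceil r)))
  have hm' : r ≤ ((m + k : ℕ) : ℝ) := by
    rw [add_comm, ← hm]
    exact Nat.le_ceil r
  rw [V.flow_eq hr hm', Function.iterate_add_apply, V.flowStep_iterate_of_le y k hk]
  exact (V.Ψ_flowStep_iterate_le (sub_nonneg.2 hk) m).2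


theorem isClosed_sublevel (b : ℝ) : IsClosed {y | V.Ψ y ≤ b} :=
  isClosed_le V.continuous_Ψ continuous_const

/-- The Palais–Smale condition at level `b`. -/
def PalaisSmaleAt (b : ℝ) : Prop :=
  ∀ y : ℕ → Y, Tendsto (fun n => V.Ψ (y n)) atTop (𝓝 b) →
    Tendsto (fun n => V.slope (y n)) atTop (𝓝 0) →
    ∃ (φ : ℕ → ℕ) (x : Y), StrictMono φ ∧ Tendsto (y ∘ φ) atTop (𝓝 x)

variable {V}

/-- A sequence violating this with `σ → 0` would subconverge to a critical point at level `b`,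
although it keeps distance `δ` from all of them. -/
theorem PalaisSmaleAt.exists_le_slope {b δ : ℝ} (hb : V.PalaisSmaleAt b) (hδ : 0 < δ) :
    ∃ σ > 0, ∀ y, b - σ ≤ V.Ψ y → V.Ψ y ≤ b + σ →
      (∀ p, V.slope p = 0 → V.Ψ p = b → δ ≤ dist y p) → σ ≤ V.slope y := by
  by_contra! h
  choose y h1 h2 h3 h4 using fun n : ℕ => h (1 / ((n : ℝ) + 1)) (by positivity)
  have h0 := tendsto_one_div_add_atTop_nhds_zero_nat (𝕜 := ℝ)
  have hΨ : Tendsto (fun n => V.Ψ (y n)) atTop (𝓝 b) := by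
    refine tendsto_of_tendsto_of_tendsto_of_le_of_le (g := fun n : ℕ => b - 1 / ((n : ℝ) + 1))
      (h := fun n : ℕ => b + 1 / ((n : ℝ) + 1)) ?_ ?_ h1 h2
    · simpa using h0.const_sub b
    · simpa using h0.const_add b
  have hs : Tendsto (fun n => V.slope (y n)) atTop (𝓝 0) :=
    squeeze_zero (fun n => V.slope_nonneg _) (fun n => (h4 n).le) h0
  obtain ⟨φ, x, hφ, hx⟩ := hb y hΨ hs
  have hxs : V.slope x = 0 :=
    tendsto_nhds_unique ((V.continuous_slope.tendsto x).comp hx) (hs.comp hφ.tendsto_atTop)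
  have hxΨ : V.Ψ x = b :=
    tendsto_nhds_unique ((V.continuous_Ψ.tendsto x).comp hx) (hΨ.comp hφ.tendsto_atTop)
  obtain ⟨n, hn⟩ := (hx.eventually (Metric.ball_mem_nhds x hδ)).exists
  have h5 := h3 (φ n) x hxs hxΨ
  have h6 : dist (y (φ n)) x < δ := hn
  linarith

section Even

variable [InvolutiveNeg Y]

theorem IsEven.τ_neg (hV : V.IsEven) (y : Y) : V.τ (-y) = V.τ y := by
  set N : Y × ℝ → Y × ℝ := fun z => (-z.1, z.2) with hN
  have hiso : Isometry N := hV.isometry_neg.prodMap isometry_id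
  have hmem : ∀ z ∈ V.bad, N z ∈ V.bad := by
    rintro ⟨x, s⟩ hz
    simpa only [bad, hN, Set.mem_ofPred_eq, hV.Ψ_neg, hV.slope_neg, hV.step_neg] using hz
  have himg : N '' V.bad = V.bad := by
    refine Set.Subset.antisymm (Set.image_subset_iff.2 hmem) fun z hz => ⟨N z, hmem z hz, ?_⟩
    simp [hN]
  have h := Metric.infDist_image (t := V.bad) (x := (y, (0 : ℝ))) hiso
  rw [himg] at h
  simp only [τ]
  rw [← h]

theorem IsEven.flow_neg (hV : V.IsEven) (y : Y) (r : ℝ) : V.flow (-y) r = -V.flow y r := by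
  have h : ∀ n : ℕ, V.flowStep^[n] (-y, r) =
      (-(V.flowStep^[n] (y, r)).1, (V.flowStep^[n] (y, r)).2) := by
    intro n
    induction n with
    | zero => rfl
    | succ n ih =>
      rw [Function.iterate_succ_apply', Function.iterate_succ_apply', ih]
      simp only [flowStep, hV.τ_neg, hV.step_neg]
  simp only [flow, h]

/-- The flow with a suitable continuous even waiting time is an odd continuous map of `A` into the
lower sublevel set, along which the odd map is pulled back. -/
theorem IsEven.oddMapOn_of_iterate_lt (hV : V.IsEven) {A : Set Y} (hA : IsClosed A)
    {l : ℝ} (hl : ∀ y ∈ A, ∃ k, V.Ψ (V.next^[k] y) < l) {k : ℕ}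
    (h : OddMapOn {y | V.Ψ y ≤ l} k) : OddMapOn A k := by
  obtain ⟨f, hf, hf'⟩ := h
  -- A sufficient number of iterations works on a neighbourhood, and sufficient times form an upper
  -- set, hence a convex one: local constants glue to a continuous time.
  obtain ⟨θ, hθ⟩ := exists_continuous_forall_mem_convex_of_local_const (E := ℝ)
    (t := fun y => {x : ℝ | y ∈ A → ∃ k : ℕ, (k : ℝ) ≤ x ∧ V.Ψ (V.next^[k] y) < l})
    (fun y => by
      refine Set.OrdConnected.convex (IsUpperSet.ordConnected fun a b hab ha hy => ?_)
      obtain ⟨k, hk, hk'⟩ := ha hy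
      exact ⟨k, hk.trans hab, hk'⟩)
    (fun y => by
      by_cases hy : y ∈ A
      · obtain ⟨k, hk⟩ := hl y hy
        refine ⟨k, ?_⟩
        have hc : Continuous fun z => V.Ψ (V.next^[k] z) :=
          V.continuous_Ψ.comp (V.continuous_next.iterate k)
        filter_upwards [hc.continuousAt.eventually (gt_mem_nhds hk)] with z hz _
        exact ⟨k, le_rfl, hz⟩
      · refine ⟨0, ?_⟩
        filter_upwards [hA.isOpen_compl.mem_nhds hy] with z hz hzA
        exact absurd hzA hz)
  -- Symmetrising by a maximum only lengthens the time, which cannot raise `Ψ` again.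
  set η : Y → ℝ := fun y => max (max (θ y) (θ (-y))) 0 with hη
  have hnegc := hV.isometry_neg.continuous
  have hηc : Continuous η :=
    (θ.continuous.max (θ.continuous.comp hnegc)).max continuous_const
  have hη0 : ∀ y, 0 ≤ η y := fun y => le_max_right _ _
  have hηneg : ∀ y, η (-y) = η y := fun y => by simp only [hη, neg_neg, max_comm (θ y)]
  have hmaps : ∀ y ∈ A, V.flow y (η y) ∈ {y | V.Ψ y ≤ l} := by
    intro y hy
    obtain ⟨k, hk, hk'⟩ := hθ y hy
    exact (V.Ψ_flow_le (hk.trans ((le_max_left _ _).trans (le_max_left _ _)))).trans hk'.le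
  refine ⟨fun y => f (V.flow y (η y)), hf.comp (V.continuous_flow hηc hη0).continuousOn hmaps,
    fun y hy => ⟨?_, (hf' _ (hmaps y hy)).2⟩⟩
  simp only [hηneg, hV.flow_neg]
  exact (hf' _ (hmaps y hy)).1

theorem IsEven.sublevel_neg (hV : V.IsEven) (b : ℝ) : ∀ y ∈ {y | V.Ψ y ≤ b}, -y ∈ {y | V.Ψ y ≤ b} :=
  fun y hy => by
    rw [Set.mem_ofPred_eq, hV.Ψ_neg]
    exact hy

/-- Crossing a level with finitely many critical points increases the genus of the sublevel set by
at most one, and not at all if there are no critical points. -/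
theorem IsEven.exists_oddMapOn_sublevel [CompleteSpace Y] (hV : V.IsEven) {b : ℝ}
    (hb : V.PalaisSmaleAt b) (hfin : {y | V.slope y = 0 ∧ V.Ψ y = b}.Finite) :
    ∃ e > 0, ∀ k, OddMapOn {y | V.Ψ y ≤ b - e} k →
      OddMapOn {y | V.Ψ y ≤ b + e} (k + 1) ∧
        ({y | V.slope y = 0 ∧ V.Ψ y = b} = ∅ → OddMapOn {y | V.Ψ y ≤ b + e} k) := by
  set K : Set Y := {y | V.slope y = 0 ∧ V.Ψ y = b} with hK
  have hKneg : ∀ x ∈ K, -x ∈ K := fun x hx => by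
    rw [hK, Set.mem_ofPred_eq, hV.slope_neg, hV.Ψ_neg]
    exact hx
  obtain ⟨f, hf, hfodd, δ, hδ, hfK⟩ := exists_odd_ne_zero_near hV.isometry_neg hV.neg_ne hfin hKneg
  obtain ⟨σ, hσ, hslope⟩ := hb.exists_le_slope (half_pos hδ)
  have hκ := V.κ_pos
  -- The first bound keeps the band where the slope estimate holds; the second makes a descent
  -- through it shorter than the gap between `δ` and `δ / 2`.
  set e : ℝ := min σ (V.κ * σ / 2 * (δ / 2) / 2) with he
  have he0 : 0 < e := lt_min hσ (by positivity)
  have heσ : e ≤ σ := min_le_left _ _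
  set A : Set Y := {y | V.Ψ y ≤ b + e} ∩ ⋂ p ∈ K, {y | δ ≤ dist y p} with hA
  have hAc : IsClosed A := (V.isClosed_sublevel _).inter (isClosed_biInter fun p _ =>
    isClosed_le continuous_const (continuous_id.dist continuous_const))
  have hAneg : ∀ y ∈ A, -y ∈ A := by
    rintro y ⟨hy1, hy2⟩
    refine ⟨hV.sublevel_neg _ y hy1, ?_⟩
    simp only [Set.mem_iInter, Set.mem_ofPred_eq] at hy2 ⊢
    intro p hp
    have h1 := hy2 (-p) (hKneg p hp)
    rwa [← hV.isometry_neg.dist_eq, neg_neg] at h1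
  refine ⟨e, he0, fun k hk => ?_⟩
  have hoddA : OddMapOn A k := by
    refine hV.oddMapOn_of_iterate_lt hAc (l := b - e) (fun y hy => ?_) hk
    refine V.exists_iterate_lt (K := K) (δ := δ) hσ ?_ (fun z h1 h2 h3 => ?_) hy.1 ?_
    · have : e ≤ V.κ * σ / 2 * (δ / 2) / 2 := min_le_right _ _
      linarith
    · exact hslope z (by linarith) (by linarith) fun p hp1 hp2 => h3 p ⟨hp1, hp2⟩
    · have := hy.2
      simpa only [Set.mem_iInter, Set.mem_ofPred_eq] using this
  constructor
  · refine (hoddA.union_ne_zero hV.isometry_neg.continuous hAc hAneg hf hfodd).mono fun y hy => ?_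
    by_cases h : ∃ p ∈ K, dist y p ≤ δ
    · exact Or.inr (hfK y h)
    · push Not at h
      refine Or.inl ⟨hy, ?_⟩
      simp only [Set.mem_iInter, Set.mem_ofPred_eq]
      exact fun p hp => (h p hp).le
  · intro hemp
    refine hoddA.mono fun y hy => ⟨hy, ?_⟩
    simp [hemp]

/-- The genus of a sublevel set is at most the number of critical levels below it. -/
theorem IsEven.oddMapOn_sublevel [CompleteSpace Y] (hV : V.IsEven) {a : ℝ} (ha : ∀ y, a ≤ V.Ψ y)
    {β₀ : EReal} (hPS : ∀ β : ℝ, (β : EReal) < β₀ → V.PalaisSmaleAt β)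
    (hfin : {y | V.slope y = 0 ∧ (V.Ψ y : EReal) < β₀}.Finite) {β : ℝ} (hβ : (β : EReal) < β₀) :
    OddMapOn {y | V.Ψ y ≤ β}
      (V.Ψ '' {y | V.slope y = 0 ∧ (V.Ψ y : EReal) < β₀} ∩ Set.Iic β).ncard := by
  set L : Set ℝ := V.Ψ '' {y | V.slope y = 0 ∧ (V.Ψ y : EReal) < β₀} with hL
  have hLfin : L.Finite := hfin.image _
  by_contra hnot
  set G : Set ℝ := {β | ∀ β' ≤ β, OddMapOn {y | V.Ψ y ≤ β'} (L ∩ Set.Iic β').ncard} with hG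
  have hGne : a - 1 ∈ G := fun β' hβ' => by
    have : {y | V.Ψ y ≤ β'} = ∅ := by
      ext y
      simp only [Set.mem_ofPred_eq, Set.mem_empty_iff_false, iff_false, not_le]
      linarith [ha y]
    rw [this]
    exact oddMapOn_empty _
  have hGub : ∀ g ∈ G, g ≤ β := fun g hg => by
    by_contra h
    exact hnot (hg β (not_le.1 h).le)
  have hGb : BddAbove G := ⟨β, hGub⟩
  set b := sSup G with hb
  have hbβ : b ≤ β := csSup_le ⟨_, hGne⟩ hGub
  have hbβ₀ : (b : EReal) < β₀ := lt_of_le_of_lt (by exact_mod_cast hbβ) hβ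
  obtain ⟨e, he, hstep⟩ := hV.exists_oddMapOn_sublevel (hPS b hbβ₀)
    (hfin.subset fun y hy => ⟨hy.1, by rw [hy.2]; exact hbβ₀⟩)
  have hlt : ∀ β' < b, OddMapOn {y | V.Ψ y ≤ β'} (L ∩ Set.Iic β').ncard := fun β' hβ' => by
    obtain ⟨g, hg, hg'⟩ := exists_lt_of_lt_csSup ⟨_, hGne⟩ hβ'
    exact hg β' hg'.le
  obtain ⟨h1, h2⟩ := hstep _ (hlt (b - e) (by linarith))
  have hmem : b + e ∈ G := by
    intro β' hβ'
    rcases lt_or_ge β' b with h | h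
    · exact hlt β' h
    have hsub : {y | V.Ψ y ≤ β'} ⊆ {y | V.Ψ y ≤ b + e} := fun y hy => le_trans hy hβ'
    have hLfin' : (L ∩ Set.Iic β').Finite := hLfin.subset Set.inter_subset_left
    have hincl : L ∩ Set.Iic (b - e) ⊆ L ∩ Set.Iic β' :=
      Set.inter_subset_inter_right _ (Set.Iic_subset_Iic.2 (by linarith))
    rcases Set.eq_empty_or_nonempty {y | V.slope y = 0 ∧ V.Ψ y = b} with hemp | ⟨p, hp⟩
    · exact ((h2 hemp).mono hsub).of_le hV.isometry_neg.continuous (V.isClosed_sublevel _)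
        (hV.sublevel_neg _) (Set.ncard_le_ncard hincl hLfin')
    · refine (h1.mono hsub).of_le hV.isometry_neg.continuous (V.isClosed_sublevel _)
        (hV.sublevel_neg _) ?_
      have hbL : b ∈ L := ⟨p, ⟨hp.1, by rw [hp.2]; exact hbβ₀⟩, hp.2⟩
      have hbn : b ∉ L ∩ Set.Iic (b - e) := fun h => by
        have : b ≤ b - e := h.2
        linarith
      rw [← Set.ncard_insert_of_notMem hbn (hLfin.subset Set.inter_subset_left)]
      exact Set.ncard_le_ncard (Set.insert_subset ⟨hbL, h⟩ hincl) hLfin'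
  have := le_csSup hGb hmem
  linarith

end Even

end DescentSystem

end Deformation

/-! ### Reduction to the unit sphere of `X⁺` -/

section SphereReduction

variable {X : Type*} [NormedAddCommGroup X] [NormedSpace ℝ X]

theorem norm_coe_sphere {H : Type*} [NormedAddCommGroup H] (y : Metric.sphere (0 : H) 1) :
    ‖(y : H)‖ = 1 :=
  mem_sphere_zero_iff_norm.1 y.2

/-- A functional satisfying the assumptions, together with a Hilbert space parametrizing the
positive summand of the splitting. -/
structure NehariSetting (S : Splitting X) (I : X → ℝ) (H : Type*) [NormedAddCommGroup H]
    [InnerProductSpace ℝ H] where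
  reflexive : IsReflexive X
  topological : S.IsTopological
  assumptions : S.Assumptions I
  contDiff : ContDiff ℝ 1 (S.energy I)
  ι : H →ₗᵢ[ℝ] X
  mem_plus_iff : ∀ p, p ∈ S.plus ↔ ∃ h, ι h = p
  ρ : ℝ
  ρ_pos : 0 < ρ
  ρ_le : ∀ u ∈ S.nehari (S.energy I), ρ ≤ ‖S.pos u‖

namespace NehariSetting

variable {S : Splitting X} {I : X → ℝ} {H : Type*} [NormedAddCommGroup H] [InnerProductSpace ℝ H]
  (E : NehariSetting S I H)

include E in
theorem differentiable : Differentiable ℝ (S.energy I) := E.contDiff.differentiable one_ne_zero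

/-- The parametrization of the Nehari–Pankov manifold by the unit sphere. -/
def m (y : Metric.sphere (0 : H) 1) : X := S.nehariMap I (E.ι y)

theorem ι_mem (h : H) : E.ι h ∈ S.plus := (E.mem_plus_iff _).2 ⟨h, rfl⟩

theorem norm_ι (y : Metric.sphere (0 : H) 1) : ‖E.ι y‖ = 1 := by
  rw [E.ι.norm_map, norm_coe_sphere]

theorem ι_ne_zero (y : Metric.sphere (0 : H) 1) : E.ι y ≠ 0 := by
  rw [← norm_ne_zero_iff, E.norm_ι]
  exact one_ne_zero

theorem m_mem (y : Metric.sphere (0 : H) 1) : E.m y ∈ S.nehari (S.energy I) :=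
  (Splitting.nehariMap_spec E.reflexive E.topological E.assumptions E.differentiable (E.ι_mem y)
    (E.ι_ne_zero y)).1

theorem pos_m (y : Metric.sphere (0 : H) 1) : S.pos (E.m y) = ‖S.pos (E.m y)‖ • E.ι y := by
  obtain ⟨-, s, hs, h⟩ := Splitting.nehariMap_spec E.reflexive E.topological E.assumptions
    E.differentiable (E.ι_mem y) (E.ι_ne_zero y)
  have h' : S.pos (E.m y) = s • E.ι y := h
  rw [h', norm_smul, E.norm_ι, mul_one, Real.norm_eq_abs, abs_of_pos hs]

theorem norm_pos_m (y : Metric.sphere (0 : H) 1) : 0 < ‖S.pos (E.m y)‖ :=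
  E.ρ_pos.trans_le (E.ρ_le _ (E.m_mem y))

theorem ι_eq (y : Metric.sphere (0 : H) 1) : E.ι y = ‖S.pos (E.m y)‖⁻¹ • S.pos (E.m y) := by
  rw [eq_inv_smul_iff₀ (E.norm_pos_m y).ne']
  exact (E.pos_m y).symm

theorem injective_m : Function.Injective E.m := by
  intro y z h
  refine Subtype.ext (E.ι.injective ?_)
  rw [E.ι_eq, E.ι_eq, h]

theorem exists_m_eq {u : X} (hu : u ∈ S.nehari (S.energy I)) :
    ∃ y : Metric.sphere (0 : H) 1, E.ι y = ‖S.pos u‖⁻¹ • S.pos u ∧ E.m y = u := by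
  have hpos : 0 < ‖S.pos u‖ := E.ρ_pos.trans_le (E.ρ_le u hu)
  obtain ⟨h, hh⟩ := (E.mem_plus_iff _).1 (S.plus.smul_mem ‖S.pos u‖⁻¹ (S.pos_mem u))
  have hn : ‖h‖ = 1 := by
    rw [← E.ι.norm_map, hh, norm_smul, norm_inv, norm_norm, inv_mul_cancel₀ hpos.ne']
  refine ⟨⟨h, mem_sphere_zero_iff_norm.2 hn⟩, hh, ?_⟩
  refine Splitting.nehariMap_eq E.reflexive E.topological E.assumptions E.differentiable hu hpos
    (E.ι_mem h) ?_
  rw [hh, smul_inv_smul₀ hpos.ne']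

theorem continuous_m : Continuous E.m := by
  rw [continuous_iff_seqContinuous]
  intro y z hyz
  exact Splitting.tendsto_nehariMap E.reflexive E.topological E.assumptions E.contDiff
    (fun n => E.ι_mem _) (fun n => E.ι_ne_zero _) (E.ι_mem _) (E.ι_ne_zero _)
    ((E.ι.continuous.comp continuous_subtype_val).continuousAt.tendsto.comp hyz)

include E in
theorem continuous_pos : Continuous S.pos := E.topological

variable [CompleteSpace H]

/-- The gradient of the reduced functional on the sphere, up to a positive factor. -/
def grad (y : Metric.sphere (0 : H) 1) : H :=
  (InnerProductSpace.toDual ℝ H).symm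
    ((fderiv ℝ (S.energy I) (E.m y)).comp E.ι.toContinuousLinearMap)

theorem inner_grad (y : Metric.sphere (0 : H) 1) (h : H) :
    inner ℝ (E.grad y) h = fderiv ℝ (S.energy I) (E.m y) (E.ι h) := by
  rw [grad, InnerProductSpace.toDual_symm_apply]
  rfl

theorem continuous_grad : Continuous E.grad := by
  refine (InnerProductSpace.toDual ℝ H).symm.continuous.comp ?_
  exact ((E.contDiff.continuous_fderiv one_ne_zero).comp E.continuous_m).clm_comp
    continuous_const

/-- The positive part of `u = E.m y` lies in `ℝu ⊕ X̃`, where `J'(u)` vanishes; so the gradient is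
already tangent to the sphere. -/
theorem inner_grad_self (y : Metric.sphere (0 : H) 1) : inner ℝ (E.grad y) (y : H) = 0 := by
  rw [E.inner_grad]
  refine (E.m_mem y).2 _ ?_
  rw [E.ι_eq]
  refine Submodule.smul_mem _ _ ?_
  have : S.pos (E.m y) = E.m y + (-S.neg (E.m y)) := by
    rw [← sub_eq_add_neg, eq_sub_iff_add_eq, S.pos_add_neg]
  rw [this]
  exact Submodule.add_mem_sup (Submodule.mem_span_singleton_self _)
    (Submodule.neg_mem _ (S.neg_mem _))

/-- As `J'(u)` vanishes on `X̃`, its restriction to `X⁺` determines it, and small slope means small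
`J'(u)` in the whole dual. -/
theorem norm_fderiv_le (y : Metric.sphere (0 : H) 1) :
    ‖fderiv ℝ (S.energy I) (E.m y)‖ ≤ ‖E.grad y‖ * ‖S.posL E.topological‖ := by
  refine ContinuousLinearMap.opNorm_le_bound _ (by positivity) fun w => ?_
  have h1 : fderiv ℝ (S.energy I) (E.m y) w = fderiv ℝ (S.energy I) (E.m y) (S.pos w) := by
    conv_lhs => rw [← S.pos_add_neg w]
    rw [map_add, (E.m_mem y).2 _ (Submodule.mem_sup_right (S.neg_mem w)), add_zero]
  obtain ⟨h, hh⟩ := (E.mem_plus_iff _).1 (S.pos_mem w)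
  rw [h1, ← hh, ← E.inner_grad, mul_assoc]
  refine (norm_inner_le_norm _ _).trans (mul_le_mul_of_nonneg_left ?_ (norm_nonneg _))
  rw [← E.ι.norm_map, hh]
  exact (S.posL E.topological).le_opNorm w

theorem grad_eq_zero_iff (y : Metric.sphere (0 : H) 1) :
    ‖E.grad y‖ = 0 ↔ fderiv ℝ (S.energy I) (E.m y) = 0 := by
  constructor
  · intro h
    have := E.norm_fderiv_le y
    rw [h, zero_mul] at this
    exact norm_le_zero_iff.1 this
  · intro h
    rw [grad, h, ContinuousLinearMap.zero_comp, map_zero, norm_zero]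

/-- The unnormalized gradient step. -/
def shift (y : Metric.sphere (0 : H) 1) (s : ℝ) : H := (y : H) - s • E.grad y

theorem one_le_norm_shift (y : Metric.sphere (0 : H) 1) (s : ℝ) : 1 ≤ ‖E.shift y s‖ := by
  have h1 : inner ℝ (y : H) (s • E.grad y) = 0 := by
    rw [inner_smul_right, real_inner_comm, E.inner_grad_self, mul_zero]
  have h2 := norm_sub_sq_real (y : H) (s • E.grad y)
  rw [h1, norm_coe_sphere] at h2
  have h3 : (1 : ℝ) ≤ ‖E.shift y s‖ ^ 2 := by
    rw [shift, h2]
    have := sq_nonneg ‖s • E.grad y‖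
    linarith
  exact (one_le_sq_iff₀ (norm_nonneg _)).1 h3

theorem norm_shift_pos (y : Metric.sphere (0 : H) 1) (s : ℝ) : 0 < ‖E.shift y s‖ :=
  zero_lt_one.trans_le (E.one_le_norm_shift y s)

/-- The normalized gradient step. -/
def step (y : Metric.sphere (0 : H) 1) (s : ℝ) : Metric.sphere (0 : H) 1 :=
  ⟨‖E.shift y s‖⁻¹ • E.shift y s, by
    rw [mem_sphere_zero_iff_norm, norm_smul, norm_inv, norm_norm,
      inv_mul_cancel₀ (E.norm_shift_pos y s).ne']⟩

theorem continuous_shift :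
    Continuous fun z : Metric.sphere (0 : H) 1 × ℝ => E.shift z.1 z.2 := by
  have := E.continuous_grad
  unfold shift
  fun_prop

theorem continuous_step :
    Continuous fun z : Metric.sphere (0 : H) 1 × ℝ => E.step z.1 z.2 :=
  Continuous.subtype_mk
    ((E.continuous_shift.norm.inv₀ fun _ => (E.norm_shift_pos _ _).ne').smul E.continuous_shift) _

theorem shift_zero (y : Metric.sphere (0 : H) 1) : E.shift y 0 = y := by simp [shift]

theorem step_zero (y : Metric.sphere (0 : H) 1) : E.step y 0 = y := by
  refine Subtype.ext ?_
  simp only [step, E.shift_zero, norm_coe_sphere, inv_one, one_smul]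

/-- The shift moves by `s * ‖E.grad y‖`, and normalising moves by `|1 - ‖E.shift y s‖|`, which is no
more than that. -/
theorem dist_step_le (y : Metric.sphere (0 : H) 1) (s : ℝ) (hs : 0 ≤ s) :
    dist (E.step y s) y ≤ 2 * s * ‖E.grad y‖ := by
  rw [Subtype.dist_eq, dist_eq_norm]
  have h0 : ‖E.shift y s - y‖ = s * ‖E.grad y‖ := by
    rw [shift, sub_sub_cancel_left, norm_neg, norm_smul, Real.norm_eq_abs, abs_of_nonneg hs]
  have h1 : ‖(E.step y s : H) - E.shift y s‖ = |‖(y : H)‖ - ‖E.shift y s‖| := by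
    have : (E.step y s : H) - E.shift y s = (‖E.shift y s‖⁻¹ - 1) • E.shift y s := by
      simp only [step, sub_smul, one_smul]
    rw [this, norm_smul, Real.norm_eq_abs, norm_coe_sphere, ← abs_of_pos (E.norm_shift_pos y s),
      ← abs_mul, sub_mul, abs_of_pos (E.norm_shift_pos y s),
      inv_mul_cancel₀ (E.norm_shift_pos y s).ne', one_mul]
  have h2 := abs_norm_sub_norm_le (y : H) (E.shift y s)
  rw [norm_sub_rev] at h2
  have h3 := norm_add_le ((E.step y s : H) - E.shift y s) (E.shift y s - y)
  rw [sub_add_sub_cancel] at h3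
  linarith

/-- No derivative of `E.m` is needed. Undoing the step at `E.m (E.step z.1 z.2)` gives a point `p z`
on the half-space of `E.m z.1`, so `J(p z) ≤ J(E.m z.1)`; strict differentiability of `J` compares
`p z` with `E.m (E.step z.1 z.2)`. -/
theorem descent (y : Metric.sphere (0 : H) 1) (hy : ‖E.grad y‖ ≠ 0) :
    ∀ᶠ z in 𝓝 ((y, 0) : Metric.sphere (0 : H) 1 × ℝ), 0 ≤ z.2 →
      S.energy I (E.m (E.step z.1 z.2)) ≤
        S.energy I (E.m z.1) - E.ρ / 4 * z.2 * ‖E.grad z.1‖ ^ 2 := by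
  have hg : 0 < ‖E.grad y‖ := lt_of_le_of_ne (norm_nonneg _) hy.symm
  set L := fderiv ℝ (S.energy I) (E.m y) with hL
  set μ : Metric.sphere (0 : H) 1 × ℝ → ℝ := fun z =>
    ‖S.pos (E.m (E.step z.1 z.2))‖ / ‖E.shift z.1 z.2‖ with hμ
  set p : Metric.sphere (0 : H) 1 × ℝ → X := fun z =>
    E.m (E.step z.1 z.2) + (μ z * z.2) • E.ι (E.grad z.1) with hp
  have hmc : Continuous fun z : Metric.sphere (0 : H) 1 × ℝ => E.m (E.step z.1 z.2) :=
    E.continuous_m.comp E.continuous_step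
  have hμc : Continuous μ := (E.continuous_pos.comp hmc).norm.div E.continuous_shift.norm
    fun _ => (E.norm_shift_pos _ _).ne'
  have hpc : Continuous p := hmc.add ((hμc.mul continuous_snd).smul
    (E.ι.continuous.comp (E.continuous_grad.comp continuous_fst)))
  have hstrict := (E.contDiff.contDiffAt (x := E.m y)).hasStrictFDerivAt one_ne_zero
  have h1 := hstrict.isLittleO.def (show (0 : ℝ) < ‖E.grad y‖ / 4 by positivity)
  have hlim : Tendsto (fun z => (E.m (E.step z.1 z.2), p z)) (𝓝 (y, 0))
      (𝓝 (E.m y, E.m y)) := by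
    have := (hmc.prodMk hpc).tendsto (y, 0)
    simpa only [hp, E.step_zero, mul_zero, zero_smul, add_zero] using this
  -- At `z.1 = y` this reads `1/2 < 3/4`, so it persists nearby. The rate `ρ / 4` is this `1/2`
  -- times the bound `ρ / 2 ≤ μ z`.
  have h2 : ∀ᶠ z in 𝓝 ((y, 0) : Metric.sphere (0 : H) 1 × ℝ), (1 / 2) * ‖E.grad z.1‖ ^ 2 <
      inner ℝ (E.grad y) (E.grad z.1) - ‖E.grad y‖ / 4 * ‖E.grad z.1‖ := by
    have hgc := E.continuous_grad
    refine ContinuousAt.eventually_lt (Continuous.continuousAt (by fun_prop))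
      (Continuous.continuousAt (by fun_prop)) ?_
    simp only [real_inner_self_eq_norm_sq]
    nlinarith
  have h3 : ∀ᶠ z in 𝓝 ((y, 0) : Metric.sphere (0 : H) 1 × ℝ), ‖E.shift z.1 z.2‖ < 2 := by
    refine E.continuous_shift.norm.continuousAt.eventually (gt_mem_nhds ?_)
    change ‖E.shift y 0‖ < 2
    rw [E.shift_zero, norm_coe_sphere]
    norm_num
  filter_upwards [hlim.eventually h1, h2, h3] with z hz1 hz2 hz3 hz0
  have hsh := E.norm_shift_pos z.1 z.2
  have hμ0 : 0 < μ z := div_pos (E.norm_pos_m _) hsh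
  have hμρ : E.ρ / 2 ≤ μ z :=
    div_le_div₀ (norm_nonneg _) (E.ρ_le _ (E.m_mem _)) hsh hz3.le
  have hpz : S.energy I (p z) ≤ S.energy I (E.m z.1) := by
    refine Splitting.energy_le_of_mem_nehari E.assumptions E.differentiable (E.m_mem z.1)
      (s := μ z / ‖S.pos (E.m z.1)‖) (by positivity) ?_
    have hι : E.ι (E.shift z.1 z.2) = E.ι z.1 - z.2 • E.ι (E.grad z.1) := by
      rw [shift, map_sub, map_smul]
    have hst : S.pos (E.m (E.step z.1 z.2)) = μ z • E.ι (E.shift z.1 z.2) := by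
      rw [E.pos_m]
      simp only [step, hμ, map_smul, smul_smul, div_eq_mul_inv]
    rw [S.pos_add, S.pos_smul, S.pos_of_mem (E.ι_mem _), hst, hι, div_eq_mul_inv, mul_smul (μ z) _ (S.pos _),
      ← E.ι_eq]
    module
  have hdiff : E.m (E.step z.1 z.2) - p z = -((μ z * z.2) • E.ι (E.grad z.1)) := by
    simp only [hp, sub_add_cancel_left]
  rw [hdiff, map_neg, map_smul, ← E.inner_grad, norm_neg, norm_smul, E.ι.norm_map,
    Real.norm_eq_abs, Real.norm_eq_abs, abs_of_nonneg (mul_nonneg hμ0.le hz0)] at hz1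
  have hz1' := (abs_le.1 hz1).2
  rw [smul_eq_mul] at hz1'
  have h4 := mul_le_mul_of_nonneg_left hz2.le (mul_nonneg hμ0.le hz0)
  have h5 : E.ρ / 2 * (z.2 * ‖E.grad z.1‖ ^ 2) ≤ μ z * (z.2 * ‖E.grad z.1‖ ^ 2) :=
    mul_le_mul_of_nonneg_right hμρ (mul_nonneg hz0 (sq_nonneg _))
  linarith

/-- The reduced functional on the sphere as a descent system. -/
def descentSystem : DescentSystem (Metric.sphere (0 : H) 1) where
  Ψ y := S.energy I (E.m y)
  slope y := ‖E.grad y‖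
  step := E.step
  κ := E.ρ / 4
  κ_pos := div_pos E.ρ_pos (by norm_num)
  continuous_Ψ := E.contDiff.continuous.comp E.continuous_m
  continuous_slope := E.continuous_grad.norm
  slope_nonneg _ := norm_nonneg _
  continuous_step := E.continuous_step
  step_zero := E.step_zero
  dist_step_le := E.dist_step_le
  descent := E.descent

theorem tendsto_fderiv {y : ℕ → Metric.sphere (0 : H) 1}
    (h : Tendsto (fun n => E.descentSystem.slope (y n)) atTop (𝓝 0)) :
    Tendsto (fun n => fderiv ℝ (S.energy I) (E.m (y n))) atTop (𝓝 0) := by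
  refine squeeze_zero_norm (fun n => E.norm_fderiv_le (y n)) ?_
  have := h.mul_const ‖S.posL E.topological‖
  rwa [zero_mul] at this

include E in
/-- There is a Palais–Smale sequence at the infimum over the Nehari–Pankov manifold. -/
theorem exists_isPSSeq {c : ℝ}
    (hc : (c : EReal) = infOn (S.energy I) (S.nehari (S.energy I))) :
    ∃ u, IsPSSeq (S.energy I) (S.nehari (S.energy I)) c u := by
  have hcomplete : CompleteSpace (Metric.sphere (0 : H) 1) :=
    Metric.isClosed_sphere.completeSpace_coe
  have hcle : ∀ u ∈ S.nehari (S.energy I), c ≤ S.energy I u := fun u hu => by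
    have := infOn_le (J := S.energy I) hu
    rw [← hc] at this
    exact_mod_cast this
  have hex : ∀ n : ℕ, ∃ y : Metric.sphere (0 : H) 1,
      S.energy I (E.m y) ≤ c + 1 / ((n : ℝ) + 1) ∧
        E.descentSystem.slope y < 1 / ((n : ℝ) + 1) := by
    intro n
    have hn : (0 : ℝ) < 1 / ((n : ℝ) + 1) := by positivity
    have h1 : infOn (S.energy I) (S.nehari (S.energy I)) < ((c + 1 / ((n : ℝ) + 1) : ℝ) : EReal) := by
      rw [← hc]
      exact_mod_cast lt_add_of_pos_right c hn
    simp only [infOn, iInf_lt_iff] at h1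
    obtain ⟨u, hu, hlt⟩ := h1
    obtain ⟨y, -, rfl⟩ := E.exists_m_eq hu
    obtain ⟨z, hz1, hz2⟩ := E.descentSystem.exists_slope_lt (fun y => hcle _ (E.m_mem y)) y hn
    have hlt' : S.energy I (E.m y) < c + 1 / ((n : ℝ) + 1) := by exact_mod_cast hlt
    exact ⟨z, le_trans hz1 hlt'.le, hz2⟩
  choose y hy1 hy2 using hex
  have h0 := tendsto_one_div_add_atTop_nhds_zero_nat (𝕜 := ℝ)
  refine ⟨fun n => E.m (y n), fun n => E.m_mem _, E.tendsto_fderiv ?_, ?_⟩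
  · exact squeeze_zero (fun n => E.descentSystem.slope_nonneg _) (fun n => (hy2 n).le) h0
  · refine tendsto_of_tendsto_of_tendsto_of_le_of_le tendsto_const_nhds ?_
      (fun n => hcle _ (E.m_mem _)) hy1
    simpa using h0.const_add c

/-- `𝒯`-convergence gives norm convergence of positive parts, and `ρ` keeps the limit away from `0`;
normalised, these are the points of the sphere. -/
theorem palaisSmaleAt {β : ℝ}
    (h : S.PSCondition (S.energy I) (S.nehari (S.energy I)) β) :
    E.descentSystem.PalaisSmaleAt β := by
  intro y hΨ hs
  obtain ⟨φ, x, hφ, hx⟩ := h (fun n => E.m (y n)) ⟨fun n => E.m_mem _, E.tendsto_fderiv hs, hΨ⟩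
  have hρx : E.ρ ≤ ‖S.pos x‖ := ge_of_tendsto' hx.1.norm fun n => E.ρ_le _ (E.m_mem _)
  have hx0 : ‖S.pos x‖ ≠ 0 := (E.ρ_pos.trans_le hρx).ne'
  obtain ⟨z, hz⟩ := (E.mem_plus_iff _).1 (S.plus.smul_mem ‖S.pos x‖⁻¹ (S.pos_mem x))
  have hzn : ‖z‖ = 1 := by
    rw [← E.ι.norm_map, hz, norm_smul, norm_inv, norm_norm, inv_mul_cancel₀ hx0]
  refine ⟨φ, ⟨z, mem_sphere_zero_iff_norm.2 hzn⟩, hφ, ?_⟩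
  rw [tendsto_subtype_rng, E.ι.isometry.isEmbedding.tendsto_nhds_iff]
  have h1 : Tendsto (fun n => ‖S.pos (E.m (y (φ n)))‖⁻¹ • S.pos (E.m (y (φ n)))) atTop
      (𝓝 (‖S.pos x‖⁻¹ • S.pos x)) := (hx.1.norm.inv₀ hx0).smul hx.1
  rw [hz]
  refine h1.congr fun n => ?_
  rw [← E.ι_eq]
  rfl

section Even

theorem fderiv_neg_of_even {J : X → ℝ} (hJ : ∀ u, J (-u) = J u) (u : X) :
    fderiv ℝ J (-u) = -fderiv ℝ J u := by
  have h : (fun x => J (-x)) = J := funext hJ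
  have h1 := (ContinuousLinearEquiv.neg ℝ (M := X)).comp_right_fderiv (f := J) (x := u)
  have h2 : J ∘ (ContinuousLinearEquiv.neg ℝ (M := X)) = J := h
  rw [h2] at h1
  ext w
  rw [h1]
  simp

theorem neg_mem_nehari {J : X → ℝ} (hJ : ∀ u, J (-u) = J u) {u : X} (hu : u ∈ S.nehari J) :
    -u ∈ S.nehari J := by
  refine ⟨fun h => hu.1 (by simpa using S.tilde.neg_mem h), fun w hw => ?_⟩
  rw [← Set.neg_singleton, Submodule.span_neg] at hw
  rw [fderiv_neg_of_even hJ, _root_.neg_apply, hu.2 w hw, neg_zero]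

variable (hJ : ∀ u, S.energy I (-u) = S.energy I u)
include hJ

omit [CompleteSpace H] in
theorem m_neg (y : Metric.sphere (0 : H) 1) : E.m (-y) = -E.m y := by
  refine Splitting.nehariMap_eq E.reflexive E.topological E.assumptions E.differentiable
    (neg_mem_nehari hJ (E.m_mem y)) (E.norm_pos_m y) (E.ι_mem _) ?_
  rw [S.pos_neg, coe_neg_sphere, map_neg, smul_neg, ← E.pos_m]

theorem grad_neg (y : Metric.sphere (0 : H) 1) : E.grad (-y) = -E.grad y := by
  rw [grad, E.m_neg hJ, fderiv_neg_of_even hJ, ContinuousLinearMap.neg_comp, map_neg, grad]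

theorem isEven : E.descentSystem.IsEven where
  isometry_neg := Isometry.of_dist_eq fun y z => by
    simp only [Subtype.dist_eq, coe_neg_sphere, dist_neg_neg]
  neg_ne y h := by
    have h1 := congrArg (fun z : Metric.sphere (0 : H) 1 => (z : H)) h
    simp only [coe_neg_sphere] at h1
    have h2 : (y : H) = 0 := by
      have h4 : (2 : ℝ) • (y : H) = 0 := by
        rw [two_smul]
        nth_rewrite 1 [← h1]
        exact neg_add_cancel _
      exact (smul_eq_zero.1 h4).resolve_left two_ne_zero
    have h3 := norm_coe_sphere y
    rw [h2, norm_zero] at h3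
    exact zero_ne_one h3
  Ψ_neg y := by
    change S.energy I (E.m (-y)) = S.energy I (E.m y)
    rw [E.m_neg hJ, hJ]
  slope_neg y := by
    change ‖E.grad (-y)‖ = ‖E.grad y‖
    rw [E.grad_neg hJ, norm_neg]
  step_neg y s := by
    have h : E.shift (-y) s = -E.shift y s := by
      simp only [shift, E.grad_neg hJ, coe_neg_sphere]
      module
    refine Subtype.ext ?_
    change ‖E.shift (-y) s‖⁻¹ • E.shift (-y) s = -(‖E.shift y s‖⁻¹ • E.shift y s)
    rw [h, norm_neg, smul_neg]

theorem genus_le {β : ℝ} {k : ℕ} (h : OddMapOn {y | E.descentSystem.Ψ y ≤ β} k) :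
    genus (S.energy I ⁻¹' Set.Ioc 0 β ∩ S.nehari (S.energy I)) ≤ k := by
  classical
  obtain ⟨f, hf, hf'⟩ := h
  refine iInf₂_le k ?_
  choose π hπ1 hπ2 using fun u : S.nehari (S.energy I) => E.exists_m_eq u.2
  have hπc : Continuous π := by
    rw [continuous_induced_rng, E.ι.isometry.isEmbedding.continuous_iff]
    have h1 : Continuous fun u : S.nehari (S.energy I) => ‖S.pos u‖⁻¹ • S.pos (u : X) := by
      have h2 : Continuous fun u : S.nehari (S.energy I) => S.pos (u : X) :=
        E.continuous_pos.comp continuous_subtype_val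
      exact (h2.norm.inv₀ fun u => (E.ρ_pos.trans_le (E.ρ_le u u.2)).ne').smul h2
    exact h1.congr fun u => (hπ1 u).symm
  have hmem : ∀ u : S.nehari (S.energy I), (u : X) ∈ S.energy I ⁻¹' Set.Ioc 0 β →
      π u ∈ {y | E.descentSystem.Ψ y ≤ β} := fun u hu => by
    change S.energy I (E.m (π u)) ≤ β
    rw [hπ2]
    exact hu.2
  refine ⟨fun u => if h : u ∈ S.nehari (S.energy I) then f (π ⟨u, h⟩) else 0, ?_, ?_⟩
  · rw [continuousOn_iff_continuous_domRestrict]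
    have h1 : Continuous fun u : ↥(S.energy I ⁻¹' Set.Ioc 0 β ∩ S.nehari (S.energy I)) =>
        f (π ⟨u, u.2.2⟩) :=
      hf.comp_continuous (hπc.comp (continuous_subtype_val.subtype_mk _))
        fun u => hmem _ u.2.1
    refine h1.congr fun u => ?_
    rw [Set.domRestrict_apply, dif_pos u.2.2]
  · rintro u ⟨hu1, hu2⟩
    have hu3 := neg_mem_nehari hJ hu2
    have hπneg : π ⟨-u, hu3⟩ = -π ⟨u, hu2⟩ := by
      refine Subtype.ext (E.ι.injective ?_)
      rw [hπ1, coe_neg_sphere, map_neg, hπ1]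
      simp only [S.pos_neg, norm_neg, smul_neg]
    simp only [dif_pos hu2, dif_pos hu3, hπneg]
    exact hf' _ (hmem ⟨u, hu2⟩ hu1)

include E in
/-- The genus of the sublevel sets of an even functional is bounded by the number of pairs of
critical points. -/
theorem genusCount_le_encard {β₀ : EReal} (hPS : ∀ β : ℝ, (β : EReal) < β₀ →
    S.PSCondition (S.energy I) (S.nehari (S.energy I)) β) :
    genusCount (S.energy I) (S.nehari (S.energy I)) β₀ ≤
      (criticalPairs (S.energy I) (infOn (S.energy I) (S.nehari (S.energy I))) β₀).encard := by
  have hcomplete : CompleteSpace (Metric.sphere (0 : H) 1) :=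
    Metric.isClosed_sphere.completeSpace_coe
  set c := infOn (S.energy I) (S.nehari (S.energy I)) with hc
  set C : Set X := {u | u ≠ 0 ∧ fderiv ℝ (S.energy I) u = 0 ∧ c ≤ (S.energy I u : EReal) ∧
    (S.energy I u : EReal) < β₀} with hC
  by_cases hfin : (criticalPairs (S.energy I) c β₀).Finite
  swap
  · rw [Set.Infinite.encard_eq hfin]
    exact le_top
  have hCfin : C.Finite := by
    refine (hfin.sUnion fun s hs => ?_).subset
      fun u hu => ⟨{u, -u}, ⟨u, hu, rfl⟩, Set.mem_insert _ _⟩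
    obtain ⟨u, -, rfl⟩ := hs
    exact Set.toFinite _
  set K : Set (Metric.sphere (0 : H) 1) :=
    {y | E.descentSystem.slope y = 0 ∧ (E.descentSystem.Ψ y : EReal) < β₀} with hK
  have hKC : ∀ y ∈ K, E.m y ∈ C := fun y hy => by
    refine ⟨fun h => ?_, (E.grad_eq_zero_iff y).1 hy.1, infOn_le (E.m_mem y), hy.2⟩
    have h1 := E.norm_pos_m y
    rw [h, S.pos_zero, norm_zero] at h1
    exact lt_irrefl _ h1
  have hKfin : K.Finite := (hCfin.preimage E.injective_m.injOn).subset hKC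
  obtain ⟨a, -, ha⟩ := Splitting.exists_pos_le_energy E.assumptions E.differentiable
  have hlevels : (E.descentSystem.Ψ '' K).encard ≤
      (criticalPairs (S.energy I) c β₀).encard := by
    -- By evenness `J` is constant on a pair, so `sSup` recovers the level from the pair.
    refine (Set.encard_le_encard ?_).trans
      (Set.encard_image_le (fun s => sSup (S.energy I '' s)) (criticalPairs (S.energy I) c β₀))
    rintro _ ⟨y, hy, rfl⟩
    refine ⟨_, ⟨E.m y, hKC y hy, rfl⟩, ?_⟩
    simp only [Set.image_pair, hJ, Set.pair_eq_singleton, csSup_singleton]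
    rfl
  refine iSup₂_le fun β hβ => ?_
  have h1 := (E.isEven hJ).oddMapOn_sublevel (fun y => ha _ (E.m_mem y))
    (fun b hb => E.palaisSmaleAt (hPS b hb)) hKfin hβ
  refine (E.genus_le hJ h1).trans (le_trans ?_ hlevels)
  rw [((hKfin.image _).subset Set.inter_subset_left).cast_ncard_eq]
  exact Set.encard_le_encard Set.inter_subset_left

end Even

end NehariSetting

end SphereReduction

/-! ### Hilbert structure on the positive summand -/

section Setting

variable {X : Type*} [NormedAddCommGroup X] [NormedSpace ℝ X] {S : Splitting X} {I : X → ℝ}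

theorem Splitting.exists_pos_le_norm_pos (hA : S.Assumptions I)
    (hJ : Differentiable ℝ (S.energy I)) :
    ∃ ρ > 0, ∀ u ∈ S.nehari (S.energy I), ρ ≤ ‖S.pos u‖ := by
  obtain ⟨a, ha, haN⟩ := exists_pos_le_energy hA hJ
  refine ⟨Real.sqrt (2 * a), Real.sqrt_pos.2 (by linarith), fun u hu => ?_⟩
  refine Real.sqrt_le_iff.2 ⟨norm_nonneg _, ?_⟩
  have h1 := haN u hu
  have h2 := energy_le_half hA u
  linarith

/-- The setting given by a splitting whose first summand is a Hilbert space for the given norm. -/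
theorem exists_nehariSetting [CompleteSpace X] (hX : IsReflexive X) (hT : S.IsTopological)
    (hA : S.Assumptions I) (hJ : ContDiff ℝ 1 (S.energy I)) (hclosed : IsClosed (S.plus : Set X))
    (hH : InnerProductSpaceable S.plus) :
    ∃ (_ : InnerProductSpace ℝ S.plus), CompleteSpace S.plus ∧
      Nonempty (NehariSetting S I S.plus) := by
  obtain ⟨ρ, hρ, hρN⟩ := Splitting.exists_pos_le_norm_pos hA (hJ.differentiable one_ne_zero)
  -- The inner product of Jordan–von Neumann induces the given norm, so the inclusion into `X` is
  -- isometric.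
  let inst : InnerProductSpace ℝ S.plus :=
    InnerProductSpace.ofNorm ℝ hH.parallelogram_identity
  refine ⟨inst, hclosed.completeSpace_coe, ⟨?_⟩⟩
  exact
    { reflexive := hX
      topological := hT
      assumptions := hA
      contDiff := hJ
      ι := S.plus.subtypeₗᵢ
      mem_plus_iff := fun p => ⟨fun h => ⟨⟨p, h⟩, rfl⟩, fun ⟨h, hh⟩ => hh ▸ h.2⟩
      ρ := ρ
      ρ_pos := hρ
      ρ_le := hρN }

end Setting

end NehariPankov

end

/-! ### Assembly of (a), (b) and (c) -/

theorem theorem3p2 {X : Type*} [NormedAddCommGroup X] [NormedSpace ℝ X] [CompleteSpace X]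
    (hX : IsReflexive X) (D : Decomposition X)
    (I Icp J Jcp : X → ℝ) (N Ncp : Set X) (c d : EReal)
    (hJ : J = D.coarse.energy I) (hJcp : Jcp = D.fine.energy Icp)
    (hN : N = D.coarse.nehari J) (hNcp : Ncp = D.fine.nehari Jcp)
    (hc : c = infOn J N) (hd : d = infOn Jcp Ncp)
    (hJ1 : ContDiff ℝ 1 J) (hJcp1 : ContDiff ℝ 1 Jcp)
    (hI : D.coarse.Assumptions I) (hIcp : D.fine.Assumptions Icp)
    (hcoe : CoerciveOn J N) (hcoecp : CoerciveOn Jcp Ncp) :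
    -- (a)
    (CondC1 D.fine J Jcp Ncp → CondC2 D.coarse I →
      ∀ β : ℝ, (β : EReal) < d → ∀ u : ℕ → X, IsPSSeq J N β u →
        ∃ (φ : ℕ → ℕ) (x : X), StrictMono φ ∧ WeakTendsto (u ∘ φ) x ∧ x ≠ 0) ∧
    -- (b)
    (CondC1 D.fine J Jcp Ncp → CondC2 D.coarse I → CondC3 J N → c < d →
      ∃ u ∈ N, fderiv ℝ J u = 0 ∧ (J u : EReal) = c) ∧
    -- (c)
    ((∀ u, J (-u) = J u) → ∀ β₀ : EReal, c < β₀ →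
      (∀ β : ℝ, (β : EReal) < β₀ → D.coarse.PSCondition J N β) →
      genusCount J N β₀ ≤ (criticalPairs J c β₀).encard) := by
  subst hJ hJcp hN hNcp hc hd
  obtain ⟨_, _, ⟨E⟩⟩ := exists_nehariSetting hX D.isTopological_coarse hI hJ1 D.isClosed_plus
    D.hilbert_plus
  refine ⟨fun hC1 hC2 β hβ u hu => ?_, fun hC1 hC2 hC3 hcd => ?_, fun heven β₀ _ hPS => ?_⟩
  · obtain ⟨φ, x, hφ, hx, hx0⟩ := exists_weak_limit_pos_ne_zero hX hJ1 hJcp1 hI hIcp hcoe hcoecp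
      hC1 hC2 hβ hu.1 hu.2.2
    exact ⟨φ, x, hφ, hx, fun h => hx0 (by rw [h, Splitting.pos_zero])⟩
  · obtain ⟨a, -, ha⟩ := Splitting.exists_pos_le_energy hI E.differentiable
    -- The level `c` is real: it is bounded below on `N`, and `c < d` excludes `⊤`, the value for
    -- empty `N`.
    have hbot : infOn (D.coarse.energy I) (D.coarse.nehari (D.coarse.energy I)) ≠ ⊥ :=
      ((EReal.bot_lt_coe a).trans_le (le_iInf₂ fun u hu => EReal.coe_le_coe_iff.2 (ha u hu))).ne'
    have hc := EReal.coe_toReal hcd.ne_top hbot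
    obtain ⟨u, hu⟩ := E.exists_isPSSeq hc
    obtain ⟨φ, x, hφ, hx, hx0⟩ := exists_weak_limit_pos_ne_zero hX hJ1 hJcp1 hI hIcp hcoe hcoecp
      hC1 hC2 (by rwa [hc]) hu.1 hu.2.2
    have hcrit := fderiv_eq_zero_of_condC3 hC3 (fun n => hu.1 (φ n)) hx
      (hu.2.1.comp hφ.tendsto_atTop)
    have hxN : x ∈ D.coarse.nehari (D.coarse.energy I) :=
      ⟨fun h => hx0 (D.coarse.pos_eq_zero_iff.2 h), fun w _ => by rw [hcrit]; rfl⟩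
    refine ⟨x, hxN, hcrit, ?_⟩
    rw [← hc]
    exact eq_infOn_of_condC3 hC3 (fun n => hu.1 (φ n)) hx hxN hc (hu.2.2.comp hφ.tendsto_atTop)
  · exact E.genusCount_le_encard heven hPS
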